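/- All graphs are finite, undirected and simple (no loops). A graph $K$ is square-free if it contains no four-cycle as a (not necessarily induced) subgraph, i.e. whenever $v_0v_1,v_1v_2,v_2v_3,v_3v_0\in E(K)$, then $v_0=v_2$ or $v_1=v_3$. The tensor product $G\times H$ has vertex set $V(G)\times V(H)$, with $(g_0,h_0)$ adjacent to $(g_1,h_1)$ if and only if $g_0g_1\in E(G)$ and $h_0h_1\in E(H)$. A homomorphism $\mu:F\to K$ can be recolored to a homomorphism $\mu^*:F\to K$ if there is a finite sequence $\mu=\mu_0,\mu_1,\dots,\mu_m=\mu^*$ of homomorphisms $F\to K$ such that $\mu_i$ and $\mu_{i+1}$ differ at no more than one vertex of $F$, for each $0\le i<m$. $C_n$ denotes the cycle of length $n$. **Theorem.** Let $K$ be a square-free graph, let $G$ and $H$ be connected non-bipartite graphs, and let $\mu:G\times H\to K$ be a graph homomorphism. Then $\mu$ can be recolored to a graph homomorphism $\mu^*:G\times H\to K$ that factors as $\mu^*=\delta\circ\gamma$ for graph homomorphisms $\gamma:G\times H\to I$ and $\delta:I\to K$, where one of the following holds: 1. $I=G$ and $\gamma$ is the projection $G\times H\to G$; 2. $I=H$ and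 $\gamma$ is the projection $G\times H\to H$; 3. $I=C_n$ for some integer $n\ge 3$. -/

import Mathlib

namespace SimpleGraph

/-- A graph is square-free if it contains no four-cycle as a subgraph: every closed
sequence of four edges `a b c d` is degenerate. -/
def SquareFree {W : Type*} (K : SimpleGraph W) : Prop :=
  ∀ a b c d : W, K.Adj a b → K.Adj b c → K.Adj c d → K.Adj d a → a = c ∨ b = d

/-- The tensor (categorical) product of two graphs. -/
def tensorProd {U V : Type*} (G : SimpleGraph U) (H : SimpleGraph V) :
    SimpleGraph (U × V) where
  Adj p q := G.Adj p.1 q.1 ∧ H.Adj p.2 q.2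
  symm := ⟨fun _ _ h => ⟨h.1.symm, h.2.symm⟩⟩
  loopless := ⟨fun _ h => h.1.ne rfl⟩

/-- The projection of the tensor product to its first factor. -/
def tensorFst {U V : Type*} (G : SimpleGraph U) (H : SimpleGraph V) :
    tensorProd G H →g G where
  toFun p := p.1
  map_rel' h := h.1

/-- The projection of the tensor product to its second factor. -/
def tensorSnd {U V : Type*} (G : SimpleGraph U) (H : SimpleGraph V) :
    tensorProd G H →g H where
  toFun p := p.2
  map_rel' h := h.2

/-- A single recoloring step between `K`-colorings (homomorphisms to `K`):
the two colorings differ at no more than one vertex. -/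
def RecolorStep {V W : Type*} {F : SimpleGraph V} {K : SimpleGraph W}
    (f g : F →g K) : Prop :=
  ∀ u v : V, f u ≠ g u → f v ≠ g v → u = v

/-- `f` can be recolored to `g`: there is a finite sequence of `K`-colorings from `f` to `g`
whose consecutive members differ at no more than one vertex. -/
def CanRecolor {V W : Type*} {F : SimpleGraph V} {K : SimpleGraph W}
    (f g : F →g K) : Prop :=
  Relation.ReflTransGen RecolorStep f g

end SimpleGraph

/-! Walks in `K` up to homotopy (cancelling backtracks) are words in a free group whose letters are
arcs. Two ideas carry the proof.

Recoloring: if every vertex `v` has an even walk `R v` from `f v` to `g v`, compatibly with edges,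
then `f` can be recolored to `g` as soon as `R` is trivial on every closed walk of `F` whose image
never backtracks (`IsHomotopy.canRecolor`). It remains to find a target and such walks.

Square-freeness makes any two paths of length two with the same ends homotopic. Hence an even walk
in one factor has a well-defined image in `K` up to homotopy, and images of even walks in different
factors commute (`zigzag_comm`). Centralizers of nontrivial elements of a free group are cyclic, so
either one factor contributes only trivial closed walks, or all closed walks map to powers of a
single element `c` (`exists_generator_closedWalkElts`).

If closed even walks of `H` are trivial, then for each `x` the colors of `(x, h)` lift to points of
a tree, the universal cover of `K`. A median of the points over an odd closed walk of `H` gives the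
color of `x`. Medians of adjacent vertices are adjacent, or equal with opposite parities; moving
those at odd distance by one arc makes all of them adjacent. The other factor is symmetric.

If all closed walks are powers of `c`, the lifted colors are sent to nearest points of the axis of
`c`, again with a parity shift by one arc. Modulo `c` the axis is a cycle mapping to `K`. -/

namespace FreeGroup

/-! ### Reduced words in a free group -/

section Letter

variable {α : Type*}

/-- The letter inverse to `l`. -/
def letterInv (l : α × Bool) : α × Bool := (l.1, !l.2)

lemma letterInv_letterInv (l : α × Bool) : letterInv (letterInv l) = l := by
  simp [letterInv]

lemma inv_mk_singleton (l : α × Bool) : (mk [l])⁻¹ = mk [letterInv l] := by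
  simp [inv_mk, invRev, letterInv]

end Letter

section Head

variable {α : Type*} [DecidableEq α]

/-- The first letter of the reduced word of an element of a free group. -/
def hd (w : FreeGroup α) : Option (α × Bool) := w.toWord.head?

lemma hd_eq_none {w : FreeGroup α} : hd w = none ↔ w = 1 := by
  simp [hd, List.head?_eq_none_iff]

lemma ne_one_of_hd {w : FreeGroup α} {l : α × Bool} (h : hd w = some l) : w ≠ 1 := by
  intro h1
  rw [hd_eq_none.2 h1] at h
  cases h

lemma hd_inv (w : FreeGroup α) :
    hd w⁻¹ = w.toWord.getLast?.map fun l => (l.1, !l.2) := by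
  simp [hd, toWord_inv, invRev]

/-- If the last letter of `u` does not cancel the first letter of `v`, the reduced word of
`u * v` is the concatenation of the reduced words. -/
lemma toWord_mul_of_hd {u v : FreeGroup α} (h : u = 1 ∨ hd u⁻¹ ≠ hd v) :
    (u * v).toWord = u.toWord ++ v.toWord := by
  rcases h with rfl | h
  · simp
  rw [toWord_mul, IsReduced.reduce_eq]
  rw [IsReduced, List.isChain_append]
  refine ⟨isReduced_toWord, isReduced_toWord, ?_⟩
  intro a ha b hb hab
  by_contra hne
  apply h
  rw [hd_inv, Option.mem_def.1 ha, hd, Option.mem_def.1 hb]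
  simp only [Option.map_some, Option.some.injEq]
  ext
  · exact hab
  · have : (!a.2) = b.2 := by
      revert hne
      cases a.2 <;> cases b.2 <;> simp
    exact this

lemma norm_mul_of_hd {u v : FreeGroup α} (h : u = 1 ∨ hd u⁻¹ ≠ hd v) :
    norm (u * v) = norm u + norm v := by
  simp [norm, toWord_mul_of_hd h]

lemma hd_mul_of_hd {u v : FreeGroup α} (hu : u ≠ 1) (h : hd u⁻¹ ≠ hd v) :
    hd (u * v) = hd u := by
  rw [hd, toWord_mul_of_hd (Or.inr h), hd, List.head?_append]
  cases hc : u.toWord.head? with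
  | none => exact absurd (hd_eq_none.1 hc) hu
  | some l => rfl

/-- Since `d` is nontrivial it keeps `u⁻¹` and `v` apart, so the absence of cancellation at the two
junctions is enough. -/
lemma norm_triple {u d v : FreeGroup α} (hd1 : d ≠ 1) (h1 : hd u ≠ hd d)
    (h2 : hd d⁻¹ ≠ hd v) : norm (u⁻¹ * d * v) = norm u + norm d + norm v := by
  have e1 : norm (u⁻¹ * d) = norm u + norm d := by
    rw [norm_mul_of_hd (Or.inr (by simpa using h1)), norm_inv_eq]
  have e2 : hd (u⁻¹ * d)⁻¹ = hd d⁻¹ := by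
    rw [mul_inv_rev, inv_inv]
    exact hd_mul_of_hd (inv_ne_one.2 hd1) (by simpa using h1.symm)
  rw [norm_mul_of_hd (Or.inr (by rwa [e2])), e1]

lemma toWord_mk_singleton (l : α × Bool) : (mk [l]).toWord = [l] := by
  simp [toWord_mk]

lemma norm_mk_singleton (l : α × Bool) : norm (mk [l]) = 1 := by
  simp [norm]

lemma hd_mk_singleton (l : α × Bool) : hd (mk [l]) = some l := by
  simp [hd]

lemma toWord_mk_singleton_mul {l : α × Bool} {w : FreeGroup α} (h : hd w ≠ some (letterInv l)) :
    (mk [l] * w).toWord = l :: w.toWord := by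
  rw [toWord_mul_of_hd, toWord_mk_singleton]
  · rfl
  · right
    rw [inv_mk_singleton, hd_mk_singleton]
    exact h.symm

lemma norm_mk_singleton_mul {l : α × Bool} {w : FreeGroup α} (h : hd w ≠ some (letterInv l)) :
    norm (mk [l] * w) = norm w + 1 := by
  simp [norm, toWord_mk_singleton_mul h]

lemma hd_mk_singleton_mul {l : α × Bool} {w : FreeGroup α} (h : hd w ≠ some (letterInv l)) :
    hd (mk [l] * w) = some l := by
  simp [hd, toWord_mk_singleton_mul h]

lemma toWord_mk_singleton_mul_of_eq {l : α × Bool} {w : FreeGroup α}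
    (h : hd w = some (letterInv l)) :
    w.toWord = letterInv l :: (mk [l] * w).toWord := by
  have hne : hd (mk [l] * w) ≠ some (letterInv (letterInv l)) := by
    rw [letterInv_letterInv]
    intro hh
    have hw : w.toWord = letterInv l :: w.toWord.tail := by
      rw [hd] at h
      cases hc : w.toWord with
      | nil => simp [hc] at h
      | cons a t => simpa [hc] using h
    have hred : IsReduced (letterInv l :: w.toWord.tail) := hw ▸ isReduced_toWord
    have hm : mk [l] * w = mk w.toWord.tail := by
      have : w = mk [letterInv l] * mk w.toWord.tail := by
        rw [mul_mk]
        conv_lhs => rw [← mk_toWord (x := w), hw]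
        rfl
      conv_lhs => rw [this, ← inv_mk_singleton]
      group
    have ht : (mk w.toWord.tail).toWord = w.toWord.tail := by
      rw [toWord_mk]
      exact (hred.infix ⟨[letterInv l], [], by simp⟩).reduce_eq
    rw [hm, hd, ht] at hh
    cases hc : w.toWord.tail with
    | nil => simp [hc] at hh
    | cons a t =>
      rw [hc] at hh hred
      have ha : a = l := by simpa using hh
      rw [isReduced_cons_cons] at hred
      have := hred.1
      simp [ha, letterInv] at this
  have := toWord_mk_singleton_mul hne
  rw [← inv_mk_singleton, inv_mul_cancel_left] at this
  exact this

lemma norm_mk_singleton_mul_of_eq {l : α × Bool} {w : FreeGroup α}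
    (h : hd w = some (letterInv l)) : norm w = norm (mk [l] * w) + 1 := by
  have := congrArg List.length (toWord_mk_singleton_mul_of_eq h)
  simpa [norm] using this

lemma even_norm_mk_singleton_mul (l : α × Bool) (w : FreeGroup α) :
    Even (norm (mk [l] * w)) ↔ ¬ Even (norm w) := by
  by_cases h : hd w = some (letterInv l)
  · rw [norm_mk_singleton_mul_of_eq h, Nat.even_add_one, not_not]
  · rw [norm_mk_singleton_mul h, Nat.even_add_one]

/-- Each cancellation removes two letters, so parity of length is a homomorphism. -/
lemma even_norm_mul (u v : FreeGroup α) :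
    Even (norm (u * v)) ↔ (Even (norm u) ↔ Even (norm v)) := by
  have key : ∀ (L : List (α × Bool)) (v : FreeGroup α),
      Even (norm (mk L * v)) ↔ (Even L.length ↔ Even (norm v)) := by
    intro L
    induction L with
    | nil => intro v; simp [← one_eq_mk]
    | cons l L ih =>
      intro v
      have : mk (l :: L) * v = mk [l] * (mk L * v) := by
        rw [← mul_assoc, mul_mk]; rfl
      rw [this, even_norm_mk_singleton_mul, ih, List.length_cons, Nat.even_add_one]
      tauto
  have := key u.toWord v
  rwa [mk_toWord] at this

end Head

/-! ### Centralizers in free groups are cyclic -/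

section Centralizer

variable {α : Type*}

/-- If nothing cancels in `mk [l] * x` and `x * mk [l]`, comparing first letters shows that `x`
starts with `l`. So every letter is the first letter of `x`, its inverse, or the first letter of
`x⁻¹`; two generators would give four letters. -/
lemma subsingleton_of_central {ι : Type*} {x : FreeGroup ι} (hx : x ≠ 1)
    (hc : ∀ y, y * x = x * y) : Subsingleton ι := by
  classical
  refine ⟨fun i j => ?_⟩
  by_contra hij
  have key : ∀ l : ι × Bool, hd x ≠ some (letterInv l) → hd x⁻¹ ≠ some l → hd x = some l := by
    intro l h1 h2
    have e1 := hd_mk_singleton_mul h1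
    rw [hc, hd_mul_of_hd hx (by rwa [hd_mk_singleton])] at e1
    exact e1
  have hx' : x⁻¹ ≠ 1 := inv_ne_one.2 hx
  obtain ⟨a, ha⟩ := Option.ne_none_iff_exists'.1 (mt hd_eq_none.1 hx)
  obtain ⟨b, hb⟩ := Option.ne_none_iff_exists'.1 (mt hd_eq_none.1 hx')
  rw [ha, hb] at key
  have k1 := key (i, true)
  have k2 := key (i, false)
  have k3 := key (j, true)
  have k4 := key (j, false)
  obtain ⟨a1, a2⟩ := a
  obtain ⟨b1, b2⟩ := b
  simp only [letterInv, ne_eq, Option.some.injEq, Prod.mk.injEq] at k1 k2 k3 k4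
  cases a2 <;> cases b2 <;> simp_all

lemma isCyclic_of_subsingleton (ι : Type*) [Subsingleton ι] : IsCyclic (FreeGroup ι) := by
  rcases isEmpty_or_nonempty ι with h | ⟨⟨i⟩⟩
  · infer_instance
  · refine ⟨of i, fun x => ?_⟩
    change x ∈ Subgroup.zpowers (of i)
    induction x using FreeGroup.induction_on with
    | C1 => exact one_mem _
    | of j => rw [Subsingleton.elim i j]; exact Subgroup.mem_zpowers _
    | inv_of j _ => rw [Subsingleton.elim i j]; exact inv_mem (Subgroup.mem_zpowers _)
    | mul x y hx hy => exact mul_mem hx hy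

/-- The centralizer of a nontrivial element of a free group is cyclic. -/
lemma isCyclic_centralizer {x : FreeGroup α} (hx : x ≠ 1) :
    IsCyclic (Subgroup.centralizer {x}) := by
  let Z := Subgroup.centralizer {x}
  have hxZ : x ∈ Z := Subgroup.mem_centralizer_singleton_iff.2 rfl
  -- By Nielsen–Schreier the centralizer is itself free, and `x` is central in it.
  have e := IsFreeGroup.toFreeGroup Z
  have hx1 : e ⟨x, hxZ⟩ ≠ 1 := by
    intro h
    rw [map_eq_one_iff e e.injective] at h
    exact hx (congrArg Subtype.val h)
  have : Subsingleton (IsFreeGroup.Generators Z) := by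
    refine subsingleton_of_central hx1 fun y => ?_
    obtain ⟨z, rfl⟩ := e.surjective y
    have hz : z * ⟨x, hxZ⟩ = ⟨x, hxZ⟩ * z :=
      Subtype.ext (Subgroup.mem_centralizer_singleton_iff.1 z.2)
    exact (e.map_mul _ _).symm.trans ((congrArg e hz).trans (e.map_mul _ _))
  have := isCyclic_of_subsingleton (IsFreeGroup.Generators Z)
  exact isCyclic_of_surjective e.symm e.symm.surjective

end Centralizer

end FreeGroup

namespace SimpleGraph

open FreeGroup (hd letterInv norm)

/-! ### Walks up to homotopy as free group elements -/

section WalkElement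

variable {W : Type*} [LinearOrder W]

/-- The letter of the free group on ordered pairs of vertices that encodes the arc from `a`
to `b`. -/
def arcLetter (a b : W) : (W × W) × Bool := if a < b then ((a, b), true) else ((b, a), false)

/-- The element of the free group that encodes the arc from `a` to `b`. -/
def arc (a b : W) : FreeGroup (W × W) := FreeGroup.mk [arcLetter a b]

lemma arcLetter_inj {a b c d : W} : arcLetter a b = arcLetter c d ↔ a = c ∧ b = d := by
  constructor
  · unfold arcLetter
    split_ifs <;> simp +contextual
  · rintro ⟨rfl, rfl⟩
    rfl

lemma letterInv_arcLetter {a b : W} (h : a ≠ b) : letterInv (arcLetter a b) = arcLetter b a := by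
  unfold arcLetter letterInv
  rcases lt_or_gt_of_ne h with h | h
  · simp [h, h.not_gt]
  · simp [h, h.not_gt]

lemma arc_inv {a b : W} (h : a ≠ b) : (arc a b)⁻¹ = arc b a := by
  rw [arc, FreeGroup.inv_mk_singleton, letterInv_arcLetter h, arc]

lemma arc_mul_arc {a b : W} (h : a ≠ b) : arc a b * arc b a = 1 := by
  rw [← arc_inv h, mul_inv_cancel]

lemma norm_arc (a b : W) : norm (arc a b) = 1 := FreeGroup.norm_mk_singleton _

lemma hd_arc (a b : W) : hd (arc a b) = some (arcLetter a b) := FreeGroup.hd_mk_singleton _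

lemma even_norm_arc_mul (a b : W) (w : FreeGroup (W × W)) :
    Even (norm (arc a b * w)) ↔ ¬ Even (norm w) := FreeGroup.even_norm_mk_singleton_mul _ _

lemma even_norm_mul_arc (a b : W) (w : FreeGroup (W × W)) :
    Even (norm (w * arc a b)) ↔ ¬ Even (norm w) := by
  rw [FreeGroup.even_norm_mul, norm_arc]
  simp

lemma norm_arc_mul {a b : W} (hab : a ≠ b) {w : FreeGroup (W × W)}
    (h : hd w ≠ some (arcLetter b a)) : norm (arc a b * w) = norm w + 1 :=
  FreeGroup.norm_mk_singleton_mul (by rwa [letterInv_arcLetter hab])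

lemma hd_arc_mul {a b : W} (hab : a ≠ b) {w : FreeGroup (W × W)}
    (h : hd w ≠ some (arcLetter b a)) : hd (arc a b * w) = some (arcLetter a b) :=
  FreeGroup.hd_mk_singleton_mul (by rwa [letterInv_arcLetter hab])

lemma norm_arc_mul_of_eq {a b : W} (hab : a ≠ b) {w : FreeGroup (W × W)}
    (h : hd w = some (arcLetter b a)) : norm w = norm (arc a b * w) + 1 :=
  FreeGroup.norm_mk_singleton_mul_of_eq (by rwa [letterInv_arcLetter hab])

variable {K : SimpleGraph W}

/-- The free group element of a walk. -/
def walkElt : ∀ {a b : W}, K.Walk a b → FreeGroup (W × W)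
  | _, _, .nil => 1
  | a, _, .cons (v := b) _ p => arc a b * walkElt p

lemma walkElt_append {a b c : W} (p : K.Walk a b) (q : K.Walk b c) :
    walkElt (p.append q) = walkElt p * walkElt q := by
  induction p with
  | nil => simp [walkElt]
  | cons h p ih => simp [walkElt, ih, mul_assoc]

lemma walkElt_reverse {a b : W} (p : K.Walk a b) : walkElt p.reverse = (walkElt p)⁻¹ := by
  induction p with
  | nil => simp [walkElt]
  | cons h p ih => simp [walkElt, ih, walkElt_append, arc_inv h.ne]

variable (K) in
/-- `w` is the element of some walk from `a` to `b`. -/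
def IsWalkElt (a b : W) (w : FreeGroup (W × W)) : Prop := ∃ p : K.Walk a b, walkElt p = w

namespace IsWalkElt

variable {a b c : W} {u w : FreeGroup (W × W)}

lemma one (a : W) : K.IsWalkElt a a 1 := ⟨.nil, rfl⟩

lemma of_adj (h : K.Adj a b) : K.IsWalkElt a b (arc a b) := ⟨.cons h .nil, by simp [walkElt]⟩

lemma mul (hu : K.IsWalkElt a b u) (hw : K.IsWalkElt b c w) : K.IsWalkElt a c (u * w) := by
  obtain ⟨p, rfl⟩ := hu
  obtain ⟨q, rfl⟩ := hw
  exact ⟨p.append q, walkElt_append p q⟩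

lemma inv (hu : K.IsWalkElt a b u) : K.IsWalkElt b a u⁻¹ := by
  obtain ⟨p, rfl⟩ := hu
  exact ⟨p.reverse, walkElt_reverse p⟩

end IsWalkElt

/-- Either a walk is homotopic to the trivial walk, or the reduced word of its element starts
with an arc that leaves its first vertex. -/
lemma walkElt_cases (n : ℕ) : ∀ {a b : W} (p : K.Walk a b), p.length ≤ n →
    (walkElt p = 1 ∧ a = b) ∨ ∃ c, ∃ _ : K.Adj a c,
      hd (walkElt p) = some (arcLetter a c) ∧
        ∃ q : K.Walk c b, q.length + 1 ≤ p.length ∧ walkElt p = arc a c * walkElt q := by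
  induction n with
  | zero =>
    intro a b p hp
    cases p with
    | nil => exact Or.inl ⟨rfl, rfl⟩
    | cons h p => simp at hp
  | succ n ih =>
    intro a b p hp
    cases p with
    | nil => exact Or.inl ⟨rfl, rfl⟩
    | @cons _ d _ h p =>
      simp only [Walk.length_cons, add_le_add_iff_right] at hp
      -- If the rest, once reduced, starts by returning to `a`, two arcs cancel and the induction
      -- jumps to the shorter walk `q`.
      by_cases hh : hd (walkElt p) = some (arcLetter d a)
      · rcases ih p hp with ⟨h1, -⟩ | ⟨c, hc, hhd, q, hq, e⟩
        · exact absurd h1 (FreeGroup.ne_one_of_hd hh)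
        · have hca : c = a := by
            rw [hhd, Option.some.injEq, arcLetter_inj] at hh
            exact hh.2
          subst hca
          have e2 : walkElt (Walk.cons h p) = walkElt q := by
            rw [walkElt, e, ← mul_assoc, arc_mul_arc h.ne, one_mul]
          rw [e2]
          rcases ih q (by omega) with h1 | ⟨c', hc', hhd', q', hq', e'⟩
          · exact Or.inl h1
          · exact Or.inr ⟨c', hc', hhd', q', by simp only [Walk.length_cons]; omega, e'⟩
      · exact Or.inr ⟨d, h, hd_arc_mul h.ne hh, p, by simp, rfl⟩

lemma IsWalkElt.cases {a b : W} {w : FreeGroup (W × W)} (hw : K.IsWalkElt a b w) :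
    (w = 1 ∧ a = b) ∨ ∃ c, ∃ _ : K.Adj a c, hd w = some (arcLetter a c) ∧
      ∃ w', K.IsWalkElt c b w' ∧ w = arc a c * w' ∧ norm w = norm w' + 1 := by
  obtain ⟨p, rfl⟩ := hw
  rcases walkElt_cases _ p le_rfl with h | ⟨c, hc, hhd, q, -, e⟩
  · exact Or.inl h
  · refine Or.inr ⟨c, hc, hhd, walkElt q, ⟨q, rfl⟩, e, ?_⟩
    rw [norm_arc_mul_of_eq hc.ne.symm hhd, e, ← mul_assoc, arc_mul_arc hc.ne.symm, one_mul]

lemma IsWalkElt.eq_of_one {a b : W} (hw : K.IsWalkElt a b 1) : a = b := by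
  rcases hw.cases with h | ⟨c, -, hhd, -⟩
  · exact h.2
  · exact absurd rfl (FreeGroup.ne_one_of_hd hhd)

lemma IsWalkElt.eq_arc {a b : W} {w : FreeGroup (W × W)} (hw : K.IsWalkElt a b w)
    (h : norm w = 1) : K.Adj a b ∧ w = arc a b := by
  rcases hw.cases with ⟨rfl, -⟩ | ⟨c, hc, -, w', hw', e, hn⟩
  · simp at h
  · have : w' = 1 := FreeGroup.norm_eq_zero.1 (by omega)
    subst this
    have := hw'.eq_of_one
    subst this
    exact ⟨hc, by rw [e, mul_one]⟩

lemma IsWalkElt.exists_walk {a b : W} {w : FreeGroup (W × W)} (hw : K.IsWalkElt a b w) :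
    ∃ p : K.Walk a b, walkElt p = w ∧ p.length = norm w := by
  induction hn : norm w generalizing a w with
  | zero =>
    have h1 := FreeGroup.norm_eq_zero.1 hn
    subst h1
    have := hw.eq_of_one
    subst this
    exact ⟨.nil, rfl, rfl⟩
  | succ n ih =>
    rcases hw.cases with ⟨rfl, -⟩ | ⟨c, hc, -, w', hw', e, hn'⟩
    · simp at hn
    · obtain ⟨p, hp, hl⟩ := ih hw' (by omega)
      exact ⟨.cons hc p, by rw [walkElt, hp, e], by simp [hl]⟩

/-- The product of the arcs of the sequence `s` from index `i` to index `i + n`. -/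
def seqElt (s : ℕ → W) (i : ℕ) : ℕ → FreeGroup (W × W)
  | 0 => 1
  | n + 1 => seqElt s i n * arc (s (i + n)) (s (i + n + 1))

lemma seqElt_add (s : ℕ → W) (i m n : ℕ) :
    seqElt s i (m + n) = seqElt s i m * seqElt s (i + m) n := by
  induction n with
  | zero => simp [seqElt]
  | succ n ih => rw [← add_assoc, seqElt, ih, seqElt, mul_assoc, add_assoc i m n]

lemma seqElt_one (s : ℕ → W) (i : ℕ) : seqElt s i 1 = arc (s i) (s (i + 1)) := by
  simp [seqElt]

lemma norm_seqElt_le (s : ℕ → W) (i n : ℕ) : norm (seqElt s i n) ≤ n := by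
  induction n with
  | zero => simp [seqElt]
  | succ n ih =>
    rw [seqElt]
    have := FreeGroup.norm_mul_le (seqElt s i n) (arc (s (i + n)) (s (i + n + 1)))
    rw [norm_arc] at this
    omega

lemma isWalkElt_seqElt {s : ℕ → W} (hs : ∀ i, K.Adj (s i) (s (i + 1))) (i n : ℕ) :
    K.IsWalkElt (s i) (s (i + n)) (seqElt s i n) := by
  induction n with
  | zero => exact .one _
  | succ n ih => exact ih.mul (.of_adj (hs _))

lemma seqElt_congr {s t : ℕ → W} {i j n : ℕ} (h : ∀ k ≤ n, s (i + k) = t (j + k)) :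
    seqElt s i n = seqElt t j n := by
  induction n with
  | zero => rfl
  | succ n ih =>
    rw [seqElt, seqElt, ih fun k hk => h k (by omega), h n (by omega), add_assoc, add_assoc,
      h (n + 1) le_rfl]

/-- A non-backtracking sequence is already reduced. The last arc is carried along because the
induction needs it to exclude cancellation. -/
lemma norm_seqElt_and_hd_inv {s : ℕ → W} (hs : ∀ i, K.Adj (s i) (s (i + 1)))
    (ht : ∀ i, s i ≠ s (i + 2)) (i n : ℕ) : norm (seqElt s i (n + 1)) = n + 1 ∧
    hd (seqElt s i (n + 1))⁻¹ = some (arcLetter (s (i + n + 1)) (s (i + n))) := by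
  induction n with
  | zero => simp [seqElt, norm_arc, arc_inv (hs i).ne, hd_arc]
  | succ n ih =>
    have hne : hd (seqElt s i (n + 1))⁻¹ ≠
        some (arcLetter (s (i + (n + 1))) (s (i + (n + 1) + 1))) := by
      rw [ih.2, Ne, Option.some.injEq, arcLetter_inj]
      exact fun h => ht (i + n) h.2
    have e : (seqElt s i (n + 1 + 1))⁻¹ =
        arc (s (i + (n + 1) + 1)) (s (i + (n + 1))) * (seqElt s i (n + 1))⁻¹ := by
      rw [seqElt, mul_inv_rev, arc_inv (hs _).ne]
    constructor
    · rw [← FreeGroup.norm_inv_eq, e, norm_arc_mul (hs _).ne.symm hne, FreeGroup.norm_inv_eq,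
        ih.1]
    · rw [e, hd_arc_mul (hs _).ne.symm hne]

lemma norm_seqElt {s : ℕ → W} (hs : ∀ i, K.Adj (s i) (s (i + 1)))
    (ht : ∀ i, s i ≠ s (i + 2)) (i n : ℕ) : norm (seqElt s i n) = n := by
  cases n with
  | zero => simp [seqElt]
  | succ n => exact (norm_seqElt_and_hd_inv hs ht i n).1

lemma hd_inv_seqElt {s : ℕ → W} (hs : ∀ i, K.Adj (s i) (s (i + 1)))
    (ht : ∀ i, s i ≠ s (i + 2)) (i n : ℕ) :
    hd (seqElt s i (n + 1))⁻¹ = some (arcLetter (s (i + n + 1)) (s (i + n))) :=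
  (norm_seqElt_and_hd_inv hs ht i n).2

lemma hd_seqElt {s : ℕ → W} (hs : ∀ i, K.Adj (s i) (s (i + 1)))
    (ht : ∀ i, s i ≠ s (i + 2)) (i n : ℕ) : hd (seqElt s i (n + 1)) = some (arcLetter (s i) (s (i + 1))) := by
  induction n generalizing i with
  | zero => simp [seqElt, hd_arc]
  | succ n ih =>
    rw [add_comm, seqElt_add, seqElt_one]
    refine hd_arc_mul (hs i).ne ?_
    rw [ih, Ne, Option.some.injEq, arcLetter_inj]
    exact fun h => ht i h.2.symm

end WalkElement

/-! ### Realizing a homotopy by recoloring -/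

section Recoloring

variable {X W : Type*} [LinearOrder W] {F : SimpleGraph X} {K : SimpleGraph W}

/-- A family of walks of even length from the values of `f` to the values of `g` that is
compatible with the edges. -/
structure IsHomotopy (f g : F →g K) (R : X → FreeGroup (W × W)) : Prop where
  isWalkElt : ∀ v, K.IsWalkElt (f v) (g v) (R v)
  even : ∀ v, Even (norm (R v))
  comm : ∀ {u v}, F.Adj u v → arc (f u) (f v) * R v = R u * arc (g u) (g v)

/-- A periodic sequence of vertices of `F`, consecutive ones adjacent, whose image under `f`
never backtracks. -/
structure IsTight (f : F →g K) (s : ℕ → X) (N : ℕ) : Prop where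
  pos : 0 < N
  periodic : ∀ i, s (i + N) = s i
  adj : ∀ i, F.Adj (s i) (s (i + 1))
  ne : ∀ i, f (s i) ≠ f (s (i + 2))

variable {f g : F →g K} {R : X → FreeGroup (W × W)}

/-- Walks of maximal length along which one cannot recolor propagate to a neighbour. -/
lemma IsHomotopy.propagate (hR : IsHomotopy f g R) {u v : X} (huv : F.Adj v u)
    (hv : R v ≠ 1) (hmax : norm (R u) ≤ norm (R v))
    (hh : hd (R v) ≠ some (arcLetter (f v) (f u))) :
    norm (R u) = norm (R v) ∧ hd (R u) = some (arcLetter (f u) (f v)) := by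
  have hfa := f.map_adj huv
  have hga := g.map_adj huv
  have e := hR.comm huv.symm
  have n1 := norm_arc_mul hfa.ne.symm hh
  have h1 := hd_arc_mul hfa.ne.symm hh
  -- The left side of `e` is reduced, of norm `norm (R v) + 1`. As `R u` is no longer than `R v`,
  -- nothing can cancel on the right side either, and both sides start with the same arc.
  have n2 := FreeGroup.norm_mul_le (R u) (arc (g u) (g v))
  rw [← e, n1, norm_arc] at n2
  have n3 : norm (R u) = norm (R v) := by omega
  refine ⟨n3, ?_⟩
  have hu1 : R u ≠ 1 := by
    intro h
    rw [h, FreeGroup.norm_one] at n3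
    exact hv (FreeGroup.norm_eq_zero.1 n3.symm)
  have hne : hd (R u)⁻¹ ≠ some (arcLetter (g u) (g v)) := by
    intro h
    have := norm_arc_mul_of_eq hga.ne h
    rw [← arc_inv hga.ne.symm, ← mul_inv_rev, FreeGroup.norm_inv_eq, FreeGroup.norm_inv_eq, ← e,
      n1] at this
    omega
  rw [← FreeGroup.hd_mul_of_hd hu1 (v := arc (g u) (g v)) (by rwa [hd_arc]), ← e, h1]

/-- If no tight closed walk obstructs the homotopy, some vertex of maximal distance can be
moved. -/
lemma IsHomotopy.exists_movable [Finite X] (hR : IsHomotopy f g R)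
    (hT : ∀ s N, IsTight f s N → R (s 0) = 1) (hne : ∃ v, R v ≠ 1) :
    ∃ v, R v ≠ 1 ∧ ∀ u, F.Adj v u → hd (R v) = some (arcLetter (f v) (f u)) := by
  by_contra! hcon
  obtain ⟨v₁, hv₁⟩ := hne
  have : Nonempty X := ⟨v₁⟩
  obtain ⟨v₀, hv₀⟩ := Finite.exists_max fun v => norm (R v)
  let S := {v : X // norm (R v) = norm (R v₀)}
  have hpos : norm (R v₀) ≠ 0 := by
    intro h
    have := hv₀ v₁
    rw [h, Nat.le_zero, FreeGroup.norm_eq_zero] at this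
    exact hv₁ this
  have hS : ∀ v : S, R v ≠ 1 := fun v h => hpos (by rw [← v.2, h, FreeGroup.norm_one])
  have hstep : ∀ v : S, ∃ u : S, F.Adj v u ∧ hd (R v) ≠ some (arcLetter (f v) (f u)) ∧
      hd (R u) = some (arcLetter (f u) (f v)) := by
    intro v
    obtain ⟨u, hu, hh⟩ := hcon v (hS v)
    obtain ⟨h1, h2⟩ := hR.propagate hu (hS v) (by rw [v.2]; exact hv₀ u) hh
    exact ⟨⟨u, h1.trans v.2⟩, hu, hh, h2⟩
  -- Iterating `nx` in the finite set `S` eventually closes up. The two conditions on first arcs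
  -- prevent the image from backtracking, so the orbit is tight although `R` is nontrivial on it.
  choose nx hadj hn1 hn2 using hstep
  obtain ⟨i, j, hij, heq⟩ :=
    Finite.exists_ne_map_eq_of_infinite fun n : ℕ => nx^[n] ⟨v₀, rfl⟩
  wlog hlt : i < j generalizing i j
  · exact this j i hij.symm heq.symm (by omega)
  have hs : ∀ k, nx^[i + (k + 1)] ⟨v₀, rfl⟩ = nx (nx^[i + k] ⟨v₀, rfl⟩) := fun k => by
    rw [← add_assoc, Function.iterate_succ_apply']
  have key := hT (fun k => (nx^[i + k] ⟨v₀, rfl⟩ : S)) (j - i)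
    { pos := by omega
      periodic := by
        intro k
        have e1 : i + (k + (j - i)) = k + j := by omega
        have e2 : i + k = k + i := by omega
        rw [e1, e2, Function.iterate_add_apply, ← heq, ← Function.iterate_add_apply]
      adj := by
        intro k
        rw [hs]
        exact hadj _
      ne := by
        intro k h
        have a1 := hn1 (nx^[i + (k + 1)] ⟨v₀, rfl⟩)
        have a2 := hn2 (nx^[i + k] ⟨v₀, rfl⟩)
        rw [← hs] at a1 a2
        rw [h] at a2
        exact a1 a2 }
  exact hS _ key

/-- A homotopy without obstructions can be realized by recoloring. -/
theorem IsHomotopy.canRecolor [Finite X] (hR : IsHomotopy f g R)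
    (hT : ∀ s N, IsTight f s N → R (s 0) = 1) : CanRecolor f g := by
  classical
  have := Fintype.ofFinite X
  -- Each move takes one vertex two arcs along its walk, so the total length drops.
  induction hn : ∑ v, norm (R v) using Nat.strong_induction_on generalizing f R with
  | _ n ih =>
  by_cases hne : ∃ v, R v ≠ 1
  swap
  · push Not at hne
    have : f = g := by
      ext v
      have := hR.isWalkElt v
      rw [hne v] at this
      exact this.eq_of_one
    rw [this]
    exact Relation.ReflTransGen.refl
  obtain ⟨v, hv, hmov⟩ := hR.exists_movable hT hne
  rcases (hR.isWalkElt v).cases with ⟨h, -⟩ | ⟨c, hc, hhd, w, hw, ew, nw⟩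
  · exact absurd h hv
  have hev := hR.even v
  -- A nontrivial even walk has a second arc, which supplies the new color `q`.
  rcases hw.cases with ⟨rfl, -⟩ | ⟨q, hq, -, w', hw', ew', nw'⟩
  · rw [nw] at hev
    simp at hev
  have hnb : ∀ u, F.Adj v u → f u = c := by
    intro u hu
    have := hmov u hu
    rw [hhd, Option.some.injEq, arcLetter_inj] at this
    exact this.2.symm
  let f' : F →g K :=
    { toFun := Function.update f v q
      map_rel' := by
        intro a b hab
        by_cases ha : a = v
        · subst ha
          rw [Function.update_self, Function.update_of_ne hab.ne.symm, hnb b hab]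
          exact hq.symm
        · by_cases hb : b = v
          · subst hb
            rw [Function.update_self, Function.update_of_ne ha, hnb a hab.symm]
            exact hq
          · rw [Function.update_of_ne ha, Function.update_of_ne hb]
            exact f.map_adj hab }
  have fv : f' v = q := Function.update_self v q f
  have fo : ∀ u, u ≠ v → f' u = f u := fun u hu => Function.update_of_ne hu _ _
  let R' := Function.update R v w'
  have rv : R' v = w' := Function.update_self _ _ _
  have ro : ∀ u, u ≠ v → R' u = R u := fun u hu => Function.update_of_ne hu _ _
  have eRv : R v = arc (f v) c * arc c q * w' := by rw [ew, ew', mul_assoc]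
  have hR' : IsHomotopy f' g R' := by
    refine ⟨fun u => ?_, fun u => ?_, fun {a b} hab => ?_⟩
    · by_cases hu : u = v
      · subst hu
        rwa [fv, rv]
      · rw [fo u hu, ro u hu]
        exact hR.isWalkElt u
    · by_cases hu : u = v
      · subst hu
        rw [rv]
        rw [nw, nw', Nat.even_add_one, Nat.even_add_one, not_not] at hev
        exact hev
      · rw [ro u hu]
        exact hR.even u
    · have hcomm := hR.comm hab
      by_cases ha : a = v
      · subst ha
        rw [fv, rv, fo b hab.ne.symm, ro b hab.ne.symm, hnb b hab]
        rw [hnb b hab, eRv, mul_assoc, mul_assoc] at hcomm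
        rw [mul_left_cancel hcomm, ← mul_assoc, arc_mul_arc hq.ne.symm, one_mul]
      · by_cases hb : b = v
        · subst hb
          rw [fv, rv, fo a ha, ro a ha, hnb a hab.symm, ← hcomm, hnb a hab.symm, eRv,
            ← mul_assoc, ← mul_assoc, arc_mul_arc hc.ne.symm, one_mul]
        · rw [fo a ha, fo b hb, ro a ha, ro b hb]
          exact hcomm
  -- All neighbours of `v` have color `c`, so a tight walk cannot pass through `v`; hence it was
  -- tight before the move.
  have hT' : ∀ s N, IsTight f' s N → R' (s 0) = 1 := by
    intro s N hs
    have hsv1 : ∀ i, s (i + 1) ≠ v := by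
      intro i hi
      have h1 := hs.adj i
      have h2 := hs.adj (i + 1)
      have h3 := hs.ne i
      rw [hi] at h1 h2
      rw [fo _ h1.ne, fo _ h2.ne.symm, hnb _ h1.symm, hnb _ h2] at h3
      exact h3 rfl
    have hsv : ∀ i, s i ≠ v := by
      intro i
      rw [← hs.periodic, show i + N = i + (N - 1) + 1 by have := hs.pos; omega]
      exact hsv1 _
    rw [ro _ (hsv 0)]
    refine hT s N ⟨hs.pos, hs.periodic, hs.adj, fun i => ?_⟩
    rw [← fo _ (hsv i), ← fo _ (hsv (i + 2))]
    exact hs.ne i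
  have hlt : ∑ u, norm (R' u) < n := by
    rw [← hn]
    refine Finset.sum_lt_sum (fun u _ => ?_) ⟨v, Finset.mem_univ v, ?_⟩
    · by_cases hu : u = v
      · subst hu
        rw [rv]
        omega
      · rw [ro u hu]
    · rw [rv]
      omega
  refine Relation.ReflTransGen.head ?_ (ih _ hlt hR' hT' rfl)
  intro a b ha hb
  have : ∀ u, f u ≠ f' u → u = v := fun u hu => by
    by_contra h
    exact hu (fo u h).symm
  rw [this a ha, this b hb]

end Recoloring

/-! ### Even walks and parity in non-bipartite graphs -/

section EvenWalks

variable {V : Type*}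

/-- Walks of even length, as sequences of steps of length two. -/
inductive TwoWalk (H : SimpleGraph V) : V → V → Type _
  | nil (h : V) : TwoWalk H h h
  | cons {h h₁ h₂ k : V} (a : H.Adj h h₁) (b : H.Adj h₁ h₂) (Q : TwoWalk H h₂ k) : TwoWalk H h k

namespace TwoWalk

variable {H : SimpleGraph V}

/-- Concatenation. -/
def append : ∀ {h k l : V}, TwoWalk H h k → TwoWalk H k l → TwoWalk H h l
  | _, _, _, nil _, R => R
  | _, _, _, cons a b Q, R => cons a b (append Q R)

/-- Reversal. -/
def reverse : ∀ {h k : V}, TwoWalk H h k → TwoWalk H k h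
  | _, _, nil h => nil h
  | _, _, cons a b Q => append (reverse Q) (cons b.symm a.symm (nil _))

end TwoWalk

variable {H : SimpleGraph V}

lemma nonempty_twoWalk_of_even : ∀ {h k : V} (p : H.Walk h k), Even p.length →
    Nonempty (TwoWalk H h k)
  | _, _, .nil, _ => ⟨.nil _⟩
  | _, _, .cons _ .nil, hp => by simp at hp
  | _, _, .cons a (.cons b p), hp => by
    obtain ⟨Q⟩ := nonempty_twoWalk_of_even p (by
      simpa [Nat.even_add_one] using hp)
    exact ⟨.cons a b Q⟩

lemma exists_odd_closed_walk (hH : ¬ H.IsBipartite) : ∃ u, ∃ p : H.Walk u u, Odd p.length := by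
  rw [IsBipartite, two_colorable_iff_forall_loop_even] at hH
  push Not at hH
  obtain ⟨u, p, hp⟩ := hH
  exact ⟨u, p, Nat.not_even_iff_odd.1 hp⟩

lemma exists_walk_parity (hc : H.Connected) (hH : ¬ H.IsBipartite) (h k : V) (n : ℕ) :
    ∃ p : H.Walk h k, (Even p.length ↔ Even n) := by
  obtain ⟨p⟩ := hc.preconnected h k
  by_cases hp : Even p.length ↔ Even n
  · exact ⟨p, hp⟩
  · obtain ⟨u, l, hl⟩ := exists_odd_closed_walk hH
    obtain ⟨q⟩ := hc.preconnected h u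
    -- A detour around an odd closed walk flips the parity.
    refine ⟨((q.append l).append q.reverse).append p, ?_⟩
    simp only [Walk.length_append, Walk.length_reverse]
    rw [← Nat.not_even_iff_odd] at hl
    simp only [Nat.even_add]
    tauto

lemma nonempty_twoWalk (hc : H.Connected) (hH : ¬ H.IsBipartite) (h k : V) :
    Nonempty (TwoWalk H h k) := by
  obtain ⟨p, hp⟩ := exists_walk_parity hc hH h k 0
  exact nonempty_twoWalk_of_even p (hp.2 (by simp))

lemma exists_adj_of_not_isBipartite (hc : H.Connected) (hH : ¬ H.IsBipartite) (h : V) :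
    ∃ k, H.Adj h k := by
  obtain ⟨p, hp⟩ := exists_walk_parity hc hH h h 1
  cases p with
  | nil => simp at hp
  | cons a _ => exact ⟨_, a⟩

end EvenWalks

/-! ### Interchanging the factors -/

section Swap

variable {U V W : Type*} {G : SimpleGraph U} {H : SimpleGraph V} {K : SimpleGraph W}

/-- The map obtained by interchanging the factors. -/
def swapHom (φ : tensorProd G H →g K) : tensorProd H G →g K where
  toFun p := φ (p.2, p.1)
  map_rel' h := φ.map_adj ⟨h.2, h.1⟩

lemma swapHom_apply (φ : tensorProd G H →g K) (h : V) (x : U) : swapHom φ (h, x) = φ (x, h) := rfl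

lemma tensor_adj {x x' : U} {h h' : V} (hx : G.Adj x x') (hh : H.Adj h h') :
    (tensorProd G H).Adj (x, h) (x', h') := ⟨hx, hh⟩

end Swap

/-! ### Images of even walks in the two factors -/

section Tensor

variable {U V W : Type*} [LinearOrder W] {G : SimpleGraph U} {H : SimpleGraph V}
  {K : SimpleGraph W}

/-- The element of the image of the walk that follows `Q` in the second factor and alternates
between `x` and `x'` in the first. -/
def zigzag (φ : tensorProd G H →g K) (x x' : U) : ∀ {h k : V}, TwoWalk H h k → FreeGroup (W × W)
  | _, _, .nil _ => 1
  | h, _, .cons (h₁ := h₁) (h₂ := h₂) _ _ Q =>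
    arc (φ (x, h)) (φ (x', h₁)) * arc (φ (x', h₁)) (φ (x, h₂)) * zigzag φ x x' Q

variable {φ : tensorProd G H →g K}

lemma zigzag_append (x x' : U) {h k l : V} (P : TwoWalk H h k) (Q : TwoWalk H k l) :
    zigzag φ x x' (P.append Q) = zigzag φ x x' P * zigzag φ x x' Q := by
  induction P with
  | nil => simp [TwoWalk.append, zigzag]
  | cons a b P ih => simp [TwoWalk.append, zigzag, ih, mul_assoc]

lemma zigzag_reverse {x x' : U} (hx : G.Adj x x') {h k : V} (Q : TwoWalk H h k) :
    zigzag φ x x' Q.reverse = (zigzag φ x x' Q)⁻¹ := by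
  induction Q with
  | nil => simp [TwoWalk.reverse, zigzag]
  | cons a b Q ih =>
    simp [TwoWalk.reverse, zigzag, zigzag_append, ih, mul_assoc,
      arc_inv (φ.map_adj (tensor_adj hx a)).ne, arc_inv (φ.map_adj (tensor_adj hx.symm b)).ne]

lemma isWalkElt_zigzag {x x' : U} (hx : G.Adj x x') {h k : V} (Q : TwoWalk H h k) :
    K.IsWalkElt (φ (x, h)) (φ (x, k)) (zigzag φ x x' Q) := by
  induction Q with
  | nil => exact .one _
  | cons a b Q ih =>
    exact ((IsWalkElt.of_adj (φ.map_adj (tensor_adj hx a))).mul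
      (.of_adj (φ.map_adj (tensor_adj hx.symm b)))).mul ih

lemma even_norm_zigzag (x x' : U) {h k : V} (Q : TwoWalk H h k) :
    Even (norm (zigzag φ x x' Q)) := by
  induction Q with
  | nil => simp [zigzag]
  | cons a b Q ih =>
    rw [zigzag, mul_assoc, even_norm_arc_mul, even_norm_arc_mul, not_not]
    exact ih

/-- A closed walk of length four in `K` is degenerate: either both paths backtrack or they coincide.
-/
lemma SquareFree.arc_mul_arc_eq (hK : K.SquareFree) {a b c d : W} (h1 : K.Adj a b)
    (h2 : K.Adj b c) (h3 : K.Adj c d) (h4 : K.Adj d a) :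
    arc a b * arc b c = arc a d * arc d c := by
  rcases hK a b c d h1 h2 h3 h4 with rfl | rfl
  · rw [arc_mul_arc h1.ne, arc_mul_arc h4.ne.symm]
  · rfl

lemma zigzag_step_eq (hK : K.SquareFree) {x x' x'' : U} (hx : G.Adj x x') (hx' : G.Adj x x'')
    {h h₁ h₂ : V} (a : H.Adj h h₁) (b : H.Adj h₁ h₂) :
    arc (φ (x, h)) (φ (x', h₁)) * arc (φ (x', h₁)) (φ (x, h₂)) =
      arc (φ (x, h)) (φ (x'', h₁)) * arc (φ (x'', h₁)) (φ (x, h₂)) :=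
  hK.arc_mul_arc_eq (φ.map_adj (tensor_adj hx a)) (φ.map_adj (tensor_adj hx.symm b))
    (φ.map_adj (tensor_adj hx' b.symm)) (φ.map_adj (tensor_adj hx'.symm a.symm))

lemma zigzag_eq (hK : K.SquareFree) {x x' x'' : U} (hx : G.Adj x x') (hx' : G.Adj x x'')
    {h k : V} (Q : TwoWalk H h k) : zigzag φ x x' Q = zigzag φ x x'' Q := by
  induction Q with
  | nil => rfl
  | cons a b Q ih => rw [zigzag, zigzag, ih, zigzag_step_eq hK hx hx' a b]

/-- A zigzag over `x'`, extended by a step from and to `x`, is a zigzag over `x`. -/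
lemma exists_zigzag_shift (x x' : U) {h h' k k' : V} (a : H.Adj h h')
    (Q : TwoWalk H h' k') (b : H.Adj k' k) : ∃ Q' : TwoWalk H h k,
      arc (φ (x, h)) (φ (x', h')) * zigzag φ x' x Q * arc (φ (x', k')) (φ (x, k)) =
        zigzag φ x x' Q' := by
  induction Q generalizing h with
  | nil => exact ⟨.cons a b (.nil _), by simp [zigzag]⟩
  | cons c d Q ih =>
    obtain ⟨Q', hQ'⟩ := ih d b
    exact ⟨.cons a c Q', by simp only [zigzag, ← hQ', mul_assoc]⟩

/-- For a single pair of steps of `P` from `x` over `x₁` to `x₂`, all middle vertices can be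
replaced by `(x₁, h₁)`. Both orders then collapse to the diagonal path `(x, h)`, `(x₁, h₁)`, `(x₂,
h₂)`. -/
lemma zigzag_step_comm (hK : K.SquareFree) {x y x' y' : U} {h h₁ h₂ h' h₂' : V}
    (a : H.Adj h h₁) (b : H.Adj h₁ h₂) (P : TwoWalk G x y) (hx : G.Adj x x') (hy : G.Adj y y')
    (hh : H.Adj h h') (hh₂ : H.Adj h₂ h₂') :
    arc (φ (x, h)) (φ (x', h₁)) * arc (φ (x', h₁)) (φ (x, h₂)) * zigzag (swapHom φ) h₂ h₂' P =
      zigzag (swapHom φ) h h' P *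
        (arc (φ (y, h)) (φ (y', h₁)) * arc (φ (y', h₁)) (φ (y, h₂))) := by
  induction P generalizing x' with
  | nil => simp [zigzag, zigzag_step_eq hK hx hy a b]
  | cons c d P ih =>
    have e1 := zigzag_step_eq (φ := swapHom φ) hK hh₂ b.symm c d
    have e2 := zigzag_step_eq (φ := swapHom φ) hK hh a c d
    simp only [swapHom_apply] at e1 e2
    have i1 := ih d.symm hy
    rw [zigzag, zigzag]
    simp only [swapHom_apply]
    rw [e1, e2, zigzag_step_eq hK hx c a b, mul_assoc _ (zigzag _ _ _ _), ← i1]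
    simp only [mul_assoc]
    rw [← mul_assoc (arc (φ (_, h₁)) (φ (_, h₂))) (arc (φ (_, h₂)) (φ (_, h₁))),
      arc_mul_arc (φ.map_adj (tensor_adj c b.symm)).ne.symm, one_mul,
      ← mul_assoc (arc (φ (_, h₁)) (φ (_, h))) (arc (φ (_, h)) (φ (_, h₁))),
      arc_mul_arc (φ.map_adj (tensor_adj d.symm a)).ne.symm, one_mul]

/-- Even walks in the two factors commute. -/
lemma zigzag_comm (hK : K.SquareFree) {x y x' y' : U} {h k h' k' : V}
    (Q : TwoWalk H h k) (P : TwoWalk G x y) (hx : G.Adj x x') (hy : G.Adj y y')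
    (hh : H.Adj h h') (hk : H.Adj k k') :
    zigzag φ x x' Q * zigzag (swapHom φ) k k' P =
      zigzag (swapHom φ) h h' P * zigzag φ y y' Q := by
  induction Q generalizing h' with
  | nil => simp [zigzag, zigzag_eq hK hh hk P]
  | cons a b Q ih =>
    rw [zigzag, zigzag, mul_assoc, ih b.symm hk, ← mul_assoc,
      zigzag_step_comm hK a b P hx hy hh b.symm, mul_assoc]

/-- The element of an even walk in the product is the product of the elements of an even walk in
the first factor and an even walk in the second. -/
lemma exists_zigzag_mul_zigzag (hK : K.SquareFree) : ∀ {u v : U × V}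
    (p : (tensorProd G H).Walk u v), Even p.length →
    ∃ (P : TwoWalk G u.1 v.1) (Q : TwoWalk H u.2 v.2), ∀ {h' y'}, H.Adj u.2 h' → G.Adj v.1 y' →
      walkElt (p.map φ) = zigzag (swapHom φ) u.2 h' P * zigzag φ v.1 y' Q
  | _, _, .nil, _ => ⟨.nil _, .nil _, by simp [walkElt, zigzag]⟩
  | _, _, .cons _ .nil, hp => by simp at hp
  | (x, h), (y, k), .cons (v := (x₁, h₁)) a (.cons (v := (x₂, h₂)) b p), hp => by
    obtain ⟨P, Q, hPQ⟩ := exists_zigzag_mul_zigzag hK p (by simpa [Nat.even_add_one] using hp)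
    refine ⟨.cons a.1 b.1 P, .cons a.2 b.2 Q, fun {h' y'} hh' hy' => ?_⟩
    have e1 := zigzag_step_eq (φ := swapHom φ) hK hh' a.2 a.1 b.1
    simp only [swapHom_apply] at e1
    -- The diagonal pair splits at `(x₂, h)` into a pair in each factor, both through `(x₁, h₁)`;
    -- the pair in the second factor is then moved past `P`.
    have e2 := zigzag_step_comm (φ := φ) hK a.2 b.2 P b.1.symm hy' hh' b.2.symm
    have e3 := hPQ b.2.symm hy'
    simp only at e1 e2 e3
    simp only [Walk.map_cons, walkElt, zigzag, swapHom_apply]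
    rw [e3, e1, mul_assoc _ (zigzag _ _ _ P), ← mul_assoc (zigzag _ _ _ P), ← e2]
    simp only [mul_assoc]
    rw [← mul_assoc (arc (φ (_, h₁)) (φ (_, h))) (arc (φ (_, h)) (φ (_, h₁))),
      arc_mul_arc (φ.map_adj (tensor_adj b.1.symm a.2)).ne.symm, one_mul]

/-- All closed even walks in the second factor, over the vertex `x` of the first and based at `h`,
have homotopically trivial image. -/
def TrivialAt (φ : tensorProd G H →g K) (x : U) (h : V) : Prop :=
  ∀ x', G.Adj x x' → ∀ Q : TwoWalk H h h, zigzag φ x x' Q = 1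

/-- A closed zigzag at `(y, k)`, conjugated by the arc from `(x, h)`, is a closed zigzag at `(x,
h)`. -/
lemma TrivialAt.of_adj (hK : K.SquareFree) {x y : U} {h k : V} (hT : TrivialAt φ x h)
    (hx : G.Adj x y) (hh : H.Adj h k) : TrivialAt φ y k := by
  intro y' hy' Q
  obtain ⟨Q', hQ'⟩ := exists_zigzag_shift (φ := φ) x y hh Q hh.symm
  rw [hT y hx, ← arc_inv (φ.map_adj (tensor_adj hx hh)).ne, mul_inv_eq_one] at hQ'
  rw [zigzag_eq hK hy' hx.symm]
  exact mul_eq_left.1 hQ'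

lemma exists_walk_length_add {h k : V} (p : H.Walk h k) (n : ℕ) :
    p.length ≠ 0 → ∃ q : H.Walk h k, q.length = p.length + 2 * n := by
  intro hp
  cases p with
  | nil => simp at hp
  | @cons _ b _ a p =>
    induction n with
    | zero => exact ⟨.cons a p, rfl⟩
    | succ n ih =>
      obtain ⟨q, hq⟩ := ih
      exact ⟨.cons a (.cons a.symm q), by simp [hq]; ring⟩

lemma nonempty_tensor_walk : ∀ (n : ℕ) {x y : U} {h k : V} (p : G.Walk x y) (q : H.Walk h k),
    p.length = n → q.length = n → Nonempty ((tensorProd G H).Walk (x, h) (y, k))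
  | 0, _, _, _, _, .nil, .nil, _, _ => ⟨.nil⟩
  | n + 1, _, _, _, _, .cons a p, .cons b q, hp, hq => by
    obtain ⟨r⟩ := nonempty_tensor_walk n p q (by simpa using hp) (by simpa using hq)
    exact ⟨.cons (tensor_adj a b) r⟩

lemma exists_walk_of_length_eq (hc : H.Connected) (hH : ¬ H.IsBipartite) (h k : V) :
    ∃ m, ∀ n, m ≤ n → Even n → ∃ q : H.Walk h k, q.length = n := by
  obtain ⟨p, hp⟩ := exists_walk_parity hc hH h k 0
  obtain ⟨h', a⟩ := exists_adj_of_not_isBipartite hc hH h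
  refine ⟨p.length + 2, fun n hn hev => ?_⟩
  have he : Even p.length := hp.2 (by simp)
  obtain ⟨q, hq⟩ := exists_walk_length_add (.cons a (.cons a.symm p)) ((n - (p.length + 2)) / 2)
    (by simp)
  refine ⟨q, ?_⟩
  rw [hq]
  simp only [Walk.length_cons]
  obtain ⟨i, hi⟩ := he
  obtain ⟨j, hj⟩ := hev
  omega

lemma tensorProd_preconnected (hG : G.Connected) (hG' : ¬ G.IsBipartite)
    (hH : H.Connected) (hH' : ¬ H.IsBipartite) : (tensorProd G H).Preconnected := by
  rintro ⟨x, h⟩ ⟨y, k⟩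
  obtain ⟨m, hm⟩ := exists_walk_of_length_eq hG hG' x y
  obtain ⟨m', hm'⟩ := exists_walk_of_length_eq hH hH' h k
  -- Each factor has walks of every large even length, so a common length exists and the two walks
  -- can be paired.
  obtain ⟨p, hp⟩ := hm (2 * (m + m')) (by omega) (by simp)
  obtain ⟨q, hq⟩ := hm' (2 * (m + m')) (by omega) (by simp)
  exact nonempty_tensor_walk _ p q hp hq

lemma TrivialAt.of_reachable (hK : K.SquareFree) {u v : U × V} (hT : TrivialAt φ u.1 u.2)
    (huv : (tensorProd G H).Reachable u v) : TrivialAt φ v.1 v.2 := by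
  obtain ⟨p⟩ := huv
  induction p with
  | nil => exact hT
  | cons a p ih => exact ih (hT.of_adj hK a.1 a.2)

end Tensor

/-! ### Periodic and tight sequences -/

section Periodic

variable {X W : Type*} {F : SimpleGraph X} {K : SimpleGraph W} {f : F →g K} {s : ℕ → X} {N : ℕ}

lemma apply_add_mul_of_periodic (hs : ∀ i, s (i + N) = s i) (i k : ℕ) : s (i + k * N) = s i := by
  induction k with
  | zero => simp
  | succ k ih => rw [add_mul, one_mul, ← add_assoc, hs, ih]

lemma IsTight.two_le (hs : IsTight f s N) : 2 ≤ N := by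
  have h0 := hs.pos
  by_contra h
  have h1 := hs.adj 0
  rw [← hs.periodic 0, show 0 + N = 0 + 1 by omega] at h1
  exact h1.ne rfl

/-- A tight sequence traversed backwards. -/
lemma IsTight.reverse (hs : IsTight f s N) : IsTight f (fun i => s (i * (N - 1))) N := by
  have hN := hs.pos
  -- Modulo the period, `N - 1` acts as `-1` on natural indices.
  have e : ∀ i, s ((i + 1) * (N - 1) + 1) = s (i * (N - 1)) := by
    intro i
    rw [add_mul, add_assoc, show 1 * (N - 1) + 1 = N by omega, hs.periodic]
  refine ⟨hN, fun i => ?_, fun i => ?_, fun i => ?_⟩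
  · rw [add_mul, mul_comm N, apply_add_mul_of_periodic hs.periodic]
  · rw [← e]
    exact (hs.adj _).symm
  · have e2 : s ((i + 1 + 1) * (N - 1) + 2) = s (i * (N - 1)) := by
      rw [← e i, add_mul (i + 1) 1, show (i + 1) * (N - 1) + 1 * (N - 1) + 2 =
        (i + 1) * (N - 1) + 1 + N by omega, hs.periodic]
    rw [← e2]
    exact (hs.ne _).symm

end Periodic

/-! ### Transport when the second factor is trivial -/

section Transport

variable {U V W : Type*} [LinearOrder W] {G : SimpleGraph U} {H : SimpleGraph V}
  {K : SimpleGraph W}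

/-- A family of even walks from the values `φ (x, h)` to `φ (x, h₀)` for which the transport from
`x` to `x'` does not depend on the second coordinates. -/
structure IsTransport (φ : tensorProd G H →g K) (h₀ : V) (w : U → V → FreeGroup (W × W))
    (m : U → U → FreeGroup (W × W)) : Prop where
  isWalkElt : ∀ x h, K.IsWalkElt (φ (x, h)) (φ (x, h₀)) (w x h)
  even : ∀ x h, Even (norm (w x h))
  base : ∀ x, w x h₀ = 1
  comm : ∀ {x x' h h'}, G.Adj x x' → H.Adj h h' →
    arc (φ (x, h)) (φ (x', h')) * w x' h' = w x h * m x x'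

variable {φ : tensorProd G H →g K}

lemma TrivialAt.zigzag_eq (hK : K.SquareFree) {x x' x'' : U} {h k : V} (hT : TrivialAt φ x h)
    (hx : G.Adj x x') (hx' : G.Adj x x'') (P Q : TwoWalk H h k) :
    zigzag φ x x' P = zigzag φ x x'' Q := by
  have := hT x' hx (P.append Q.reverse)
  rw [zigzag_append, zigzag_reverse hx, mul_inv_eq_one] at this
  rw [this, SimpleGraph.zigzag_eq hK hx hx']

lemma exists_isTransport (hK : K.SquareFree) (hG : ∀ x, ∃ x', G.Adj x x')
    (hH : ∀ h, ∃ h', H.Adj h h') (hW : ∀ h k, Nonempty (TwoWalk H h k))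
    (hT : ∀ x h, TrivialAt φ x h) (h₀ : V) : ∃ w m, IsTransport φ h₀ w m := by
  choose nb hnb using hG
  obtain ⟨h₁, hh₁⟩ := hH h₀
  have Q : ∀ h, TwoWalk H h h₀ := fun h => (hW h h₀).some
  let w : U → V → FreeGroup (W × W) := fun x h => zigzag φ x (nb x) (Q h)
  -- The transport is read off at the pair `h₀`, `h₁`. Any other adjacent pair gives the same result
  -- because zigzags with the same ends have equal images.
  refine ⟨w, fun x x' => (w x h₀)⁻¹ * (arc (φ (x, h₀)) (φ (x', h₁)) * w x' h₁),
    fun x h => isWalkElt_zigzag (hnb x) _, fun x h => even_norm_zigzag _ _ _,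
    fun x => hT x h₀ _ (hnb x) _, fun {x x' h h'} hx hh => ?_⟩
  obtain ⟨P⟩ := hW h' h₁
  obtain ⟨P', hP'⟩ := exists_zigzag_shift (φ := φ) x x' hh P hh₁.symm
  have e1 : w x' h' = zigzag φ x' x P * w x' h₁ := by
    change zigzag φ x' (nb x') (Q h') = _ * zigzag φ x' (nb x') (Q h₁)
    rw [(hT x' h').zigzag_eq hK (hnb x') hx.symm (Q h') (P.append (Q h₁)), zigzag_append,
      zigzag_eq hK hx.symm (hnb x') (Q h₁)]
  have e2 : w x h = zigzag φ x x' P' * w x h₀ := by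
    change zigzag φ x (nb x) (Q h) = _ * zigzag φ x (nb x) (Q h₀)
    rw [(hT x h).zigzag_eq hK (hnb x) hx (Q h) (P'.append (Q h₀)), zigzag_append,
      zigzag_eq hK hx (hnb x) (Q h₀)]
  rw [e1, e2, ← hP', ← arc_inv (φ.map_adj (tensor_adj hx hh₁)).ne]
  group

/-- The product of the transports along a sequence. -/
def transportSeq (m : U → U → FreeGroup (W × W)) (x : ℕ → U) : ℕ → FreeGroup (W × W)
  | 0 => 1
  | n + 1 => transportSeq m x n * m (x n) (x (n + 1))

variable {h₀ : V} {w : U → V → FreeGroup (W × W)} {m : U → U → FreeGroup (W × W)}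

/-- The relation `comm` telescopes. The transport on the right depends only on first coordinates, so
walks with different second coordinates can be compared. -/
lemma IsTransport.seqElt_mul (hw : IsTransport φ h₀ w m) (x : ℕ → U) (y : ℕ → V) (n : ℕ)
    (hx : ∀ i < n, G.Adj (x i) (x (i + 1))) (hy : ∀ i < n, H.Adj (y i) (y (i + 1))) :
    seqElt (fun i => φ (x i, y i)) 0 n * w (x n) (y n) =
      w (x 0) (y 0) * transportSeq m x n := by
  induction n with
  | zero => simp [seqElt, transportSeq]
  | succ n ih =>
    rw [seqElt, mul_assoc, zero_add, hw.comm (hx n (by omega)) (hy n (by omega)), ← mul_assoc,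
      ih (fun i hi => hx i (by omega)) (fun i hi => hy i (by omega)), transportSeq, mul_assoc]

/-- Replace the second coordinates of a repeated tight walk by a walk to `h` of the same length `L`.
The new image is the old one times the element in question. The old one has norm `L` and the new one
at most `L`, so a nontrivial element must cancel the last arc of the tight walk. -/
lemma IsTransport.hd_of_tight (hw : IsTransport φ h₀ w m) (hH : H.Connected)
    (hH' : ¬ H.IsBipartite) {s : ℕ → U × V} {N : ℕ} (hs : IsTight φ s N) (h : V) :
    w (s 0).1 (s 0).2 * (w (s 0).1 h)⁻¹ = 1 ∨
      hd (w (s 0).1 (s 0).2 * (w (s 0).1 h)⁻¹) =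
        some (arcLetter (φ (s 0)) (φ (s (N - 1)))) := by
  obtain ⟨l, hl⟩ := exists_walk_of_length_eq hH hH' (s 0).2 h
  have hN := hs.pos
  -- The length is even and at least `l`, so `q` exists, and it is a multiple of `N`, so the tight
  -- walk closes up.
  obtain ⟨q, hq⟩ := hl (2 * (l + 1) * N) (by nlinarith) (by simp [mul_assoc])
  set L := 2 * (l + 1) * N with hL
  have hsL : s L = s 0 := by
    have := apply_add_mul_of_periodic hs.periodic 0 (2 * (l + 1))
    rwa [zero_add] at this
  have hL1 : N ≤ L := by rw [hL]; nlinarith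
  have e1 := hw.seqElt_mul (fun i => (s i).1) (fun i => (s i).2) L
    (fun i _ => (hs.adj i).1) (fun i _ => (hs.adj i).2)
  have e2 := hw.seqElt_mul (fun i => (s i).1) q.getVert L
    (fun i _ => (hs.adj i).1) (fun i hi => q.adj_getVert_succ (by omega))
  have hqL : q.getVert L = h := by rw [← hq, Walk.getVert_length]
  simp only [hsL, hqL, Walk.getVert_zero, Prod.mk.eta] at e1 e2
  rw [← e1, ← eq_mul_inv_iff_mul_eq, mul_assoc] at e2
  have n1 := norm_seqElt_le (fun i => φ ((s i).1, q.getVert i)) 0 L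
  rw [e2] at n1
  have hadj : ∀ i, K.Adj (φ (s i)) (φ (s (i + 1))) := fun i => φ.map_adj (hs.adj i)
  have n2 := norm_seqElt hadj hs.ne 0 L
  have h2 := hd_inv_seqElt hadj hs.ne 0 (L - 1)
  have hsL' : s (L - 1) = s (N - 1) := by
    have := apply_add_mul_of_periodic hs.periodic (N - 1) (2 * l + 1)
    rw [← this, hL]
    congr 1
    have : 2 * (l + 1) * N = N + (2 * l + 1) * N := by ring
    omega
  rw [show L - 1 + 1 = L by omega, zero_add, hsL', show L - 1 + 1 = L by omega, hsL] at h2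
  by_contra! hcon
  rw [FreeGroup.norm_mul_of_hd (Or.inr (by rw [h2]; exact hcon.2.symm)), n2] at n1
  exact hcon.1 (FreeGroup.norm_eq_zero.1 (by omega))

/-- Along a tight closed walk, the values do not depend on the second coordinate. -/
lemma IsTransport.eq_one_of_tight (hw : IsTransport φ h₀ w m) (hH : H.Connected)
    (hH' : ¬ H.IsBipartite) {s : ℕ → U × V} {N : ℕ} (hs : IsTight φ s N) (h : V) :
    w (s 0).1 h = 1 := by
  have key : ∀ h, w (s 0).1 (s 0).2 * (w (s 0).1 h)⁻¹ = 1 := by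
    intro h
    rcases hw.hd_of_tight hH hH' hs h with h1 | h1
    · exact h1
    -- Traversing the walk backwards forces the same first arc to point to `φ (s 1)` as well, which
    -- contradicts tightness at `s 0`.
    · have h2 := hw.hd_of_tight hH hH' hs.reverse h
      simp only [zero_mul] at h2
      rcases h2 with h2 | h2
      · exact h2
      · exfalso
        rw [h1, Option.some.injEq, arcLetter_inj] at h2
        have hN := hs.two_le
        -- This index is the square of `-1` modulo `N`.
        have e1 : s ((N - 1) * (N - 1)) = s 1 := by
          have := apply_add_mul_of_periodic hs.periodic 1 (N - 2)
          rw [← this]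
          congr 1
          obtain ⟨M, rfl⟩ := Nat.exists_eq_add_of_le hN
          rw [show 2 + M - 1 = M + 1 by omega, show 2 + M - 2 = M by omega]
          ring
        have e2 : s (N - 1 + 2) = s 1 := by
          rw [show N - 1 + 2 = 1 + N by omega, hs.periodic]
        have := hs.ne (N - 1)
        rw [e2, ← e1] at this
        exact this h2.2
  have k1 := key h₀
  have k2 := key h
  rw [hw.base, inv_one, mul_one] at k1
  rw [k1, one_mul, inv_eq_one] at k2
  exact k2

end Transport

/-! ### Medians of an odd number of points in a tree -/

section Majority

variable {W : Type*} [LinearOrder W] {K : SimpleGraph W}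

/-- An odd number of walks from `a` has a median: from its end, no direction contains half of
the end points. -/
lemma exists_majority {ι : Type*} [Fintype ι] (hι : Odd (Fintype.card ι)) (a : W)
    (p : ι → FreeGroup (W × W)) : ∃ b M, K.IsWalkElt a b M ∧ ∀ c, K.Adj b c →
      2 * (Finset.univ.filter fun i => hd (M⁻¹ * p i) = some (arcLetter b c)).card <
        Fintype.card ι := by
  let S := {q : W × FreeGroup (W × W) // K.IsWalkElt a q.1 q.2}
  have : Nonempty S := ⟨⟨(a, 1), .one a⟩⟩
  -- The median minimizes the total distance to the points.
  let cost : S → ℕ := fun q => ∑ i, norm (q.1.2⁻¹ * p i)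
  obtain ⟨⟨⟨b, M⟩, hM⟩, hmin⟩ : ∃ q, ∀ q', cost q ≤ cost q' :=
    ⟨Function.argmin cost, fun q' => Function.argmin_le cost q'⟩
  refine ⟨b, M, hM, fun c hc => ?_⟩
  have h1 := hmin ⟨(c, M * arc b c), hM.mul (.of_adj hc)⟩
  simp only [cost, mul_inv_rev, arc_inv hc.ne, mul_assoc] at h1
  set A := Finset.univ.filter fun i => hd (M⁻¹ * p i) = some (arcLetter b c) with hA
  -- A step to `c` brings the points of `A` nearer by one and takes all others farther by one.
  have h2 : ∑ i, norm (arc c b * (M⁻¹ * p i)) + 2 * A.card =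
      ∑ i, norm (M⁻¹ * p i) + Fintype.card ι := by
    have e1 : A.card = ∑ i, if hd (M⁻¹ * p i) = some (arcLetter b c) then 1 else 0 := by
      rw [hA, Finset.card_filter]
    have e2 : Fintype.card ι = ∑ _i : ι, 1 := by simp
    rw [e1, e2, Finset.mul_sum, ← Finset.sum_add_distrib, ← Finset.sum_add_distrib]
    refine Finset.sum_congr rfl fun i _ => ?_
    split_ifs with h
    · rw [norm_arc_mul_of_eq hc.ne.symm h]
      ring
    · rw [norm_arc_mul hc.ne.symm h]
      ring
  -- Minimality only gives `≤`; an odd number of points makes it strict.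
  obtain ⟨k, hk⟩ := hι
  omega

lemma IsWalkElt.exists_hd {a b : W} {w : FreeGroup (W × W)} (hw : K.IsWalkElt a b w)
    (h1 : w ≠ 1) : ∃ c, K.Adj a c ∧ hd w = some (arcLetter a c) := by
  rcases hw.cases with ⟨h, -⟩ | ⟨c, hc, h, -⟩
  · exact absurd h h1
  · exact ⟨c, hc, h⟩

/-- Two sets of less than half the size each cannot cover everything, even after pulling one back
along `τ`. -/
lemma exists_notMem_and_notMem {ι : Type*} [Fintype ι] (A B : Finset ι) (τ : ι ≃ ι)
    (hA : 2 * A.card < Fintype.card ι) (hB : 2 * B.card < Fintype.card ι) :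
    ∃ i, i ∉ A ∧ τ i ∉ B := by
  classical
  by_contra! hcon
  have : (Finset.univ : Finset ι) ⊆ A ∪ B.map τ.symm.toEmbedding := by
    intro i _
    by_cases hi : i ∈ A
    · exact Finset.mem_union_left _ hi
    · exact Finset.mem_union_right _ (by
        rw [Finset.mem_map_equiv]
        exact hcon i hi)
  have h1 := (Finset.card_le_card this).trans (Finset.card_union_le _ _)
  rw [Finset.card_map, Finset.card_univ] at h1
  omega

end Majority

/-! ### Recoloring to a projection -/

section Projection

variable {U V W : Type*} [LinearOrder W] {G : SimpleGraph U} {H : SimpleGraph V}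
  {K : SimpleGraph W} {φ : tensorProd G H →g K}

lemma exists_cyclic_sequence (hH' : ¬ H.IsBipartite) :
    ∃ n, ∃ s : Fin (n + 1) → V, Odd (n + 1) ∧ ∀ i, H.Adj (s i) (s (i + 1)) := by
  obtain ⟨u, p, hp⟩ := exists_odd_closed_walk hH'
  obtain ⟨n, hn⟩ : ∃ n, p.length = n + 1 :=
    Nat.exists_eq_succ_of_ne_zero fun h => by simp [h] at hp
  refine ⟨n, fun i => p.getVert i, hn ▸ hp, fun i => ?_⟩
  have h1 := p.adj_getVert_succ (i := i) (by omega)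
  change H.Adj (p.getVert i) (p.getVert ((i + 1 : Fin (n + 1)) : ℕ))
  by_cases hi : i = Fin.last n
  · subst hi
    rw [Fin.val_last, ← hn, Walk.getVert_length] at h1
    simpa using h1
  · rw [Fin.val_add_one_of_lt (Fin.lt_last_iff_ne_last.2 hi)]
    exact h1

/-- The medians over adjacent vertices are adjacent, or they agree and have different parity. -/
lemma IsTransport.majority_step {h₀ : V} {w : U → V → FreeGroup (W × W)}
    {m : U → U → FreeGroup (W × W)} (hw : IsTransport φ h₀ w m) {n : ℕ} {s : Fin (n + 1) → V}
    (hs : ∀ i, H.Adj (s i) (s (i + 1))) {x x' : U} (hx : G.Adj x x') {b b' : W}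
    {M M' : FreeGroup (W × W)} (hM : K.IsWalkElt (φ (x, h₀)) b M)
    (hM' : K.IsWalkElt (φ (x', h₀)) b' M')
    (hmaj : ∀ c, K.Adj b c → 2 * (Finset.univ.filter fun i =>
      hd (M⁻¹ * (w x (s i))⁻¹) = some (arcLetter b c)).card < Fintype.card (Fin (n + 1)))
    (hmaj' : ∀ c, K.Adj b' c → 2 * (Finset.univ.filter fun i =>
      hd (M'⁻¹ * (w x' (s i))⁻¹) = some (arcLetter b' c)).card < Fintype.card (Fin (n + 1))) :
    (M⁻¹ * m x x' * M' = arc b b' ∧ K.Adj b b' ∧ Even (norm M) ∧ Even (norm M')) ∨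
      (M⁻¹ * m x x' * M' = 1 ∧ b = b' ∧ ¬ (Even (norm M) ↔ Even (norm M'))) := by
  have em : ∀ i, m x x' = (w x (s i))⁻¹ *
      (arc (φ (x, s i)) (φ (x', s (i + 1))) * w x' (s (i + 1))) := fun i => by
    rw [hw.comm hx (hs i), inv_mul_cancel_left]
  have hmw : K.IsWalkElt (φ (x, h₀)) (φ (x', h₀)) (m x x') := by
    rw [em 0]
    exact (hw.isWalkElt _ _).inv.mul
      ((IsWalkElt.of_adj (φ.map_adj (tensor_adj hx (hs 0)))).mul (hw.isWalkElt _ _))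
  have hmp : ¬ Even (norm (m x x')) := by
    have h1 := hw.even x (s 0)
    have h2 := hw.even x' (s (0 + 1))
    rw [em 0, FreeGroup.even_norm_mul, FreeGroup.norm_inv_eq, even_norm_arc_mul]
    tauto
  have hd : K.IsWalkElt b b' (M⁻¹ * m x x' * M') := (hM.inv.mul hmw).mul hM'
  by_cases h1 : M⁻¹ * m x x' * M' = 1
  · right
    refine ⟨h1, ?_, fun h => ?_⟩
    · rw [h1] at hd
      exact hd.eq_of_one
    · have := FreeGroup.even_norm_mul (M⁻¹ * m x x') M'
      rw [h1, FreeGroup.even_norm_mul, FreeGroup.norm_inv_eq, FreeGroup.norm_one] at this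
      simp only [Even.zero, true_iff] at this
      tauto
  · left
    obtain ⟨c, hc, hdc⟩ := hd.exists_hd h1
    obtain ⟨c', hc', hdc'⟩ := hd.inv.exists_hd (inv_ne_one.2 h1)
    -- Choose `i` so that the walk from one median to the lift over `s i`, and from the other to the
    -- lift over `s (i + 1)`, both avoid the direction of the other median. Nothing cancels in the
    -- concatenation, yet it is a single arc; so the medians are one arc apart and are themselves
    -- these two lifts.
    obtain ⟨i, hi, hi'⟩ := exists_notMem_and_notMem _ _ (Equiv.addRight 1) (hmaj c hc)
      (hmaj' c' hc')
    simp only [Finset.mem_filter, Finset.mem_univ, true_and, Equiv.coe_addRight] at hi hi'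
    have e := FreeGroup.norm_triple (u := M⁻¹ * (w x (s i))⁻¹)
      (v := M'⁻¹ * (w x' (s (i + 1)))⁻¹) h1 (by rwa [hdc]) (by rw [hdc']; exact Ne.symm hi')
    have e' : (M⁻¹ * (w x (s i))⁻¹)⁻¹ * (M⁻¹ * m x x' * M') * (M'⁻¹ * (w x' (s (i + 1)))⁻¹) =
        arc (φ (x, s i)) (φ (x', s (i + 1))) := by
      rw [em i]
      group
    rw [e', norm_arc] at e
    have hpos : norm (M⁻¹ * m x x' * M') ≠ 0 := fun h => h1 (FreeGroup.norm_eq_zero.1 h)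
    obtain ⟨hadj, heq⟩ := hd.eq_arc (by omega)
    refine ⟨heq, hadj, ?_, ?_⟩
    · have : M⁻¹ * (w x (s i))⁻¹ = 1 := FreeGroup.norm_eq_zero.1 (by omega)
      rw [inv_mul_eq_one] at this
      rw [this, FreeGroup.norm_inv_eq]
      exact hw.even _ _
    · have : M'⁻¹ * (w x' (s (i + 1)))⁻¹ = 1 := FreeGroup.norm_eq_zero.1 (by omega)
      rw [inv_mul_eq_one] at this
      rw [this, FreeGroup.norm_inv_eq]
      exact hw.even _ _

/-- If closed even walks in the second factor have trivial image, the coloring can be recolored to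
one that factors through the first projection. -/
theorem exists_canRecolor_tensorFst [Finite U] [Finite V] (hK : K.SquareFree)
    (hG : ∀ x, ∃ x', G.Adj x x') (hH : H.Connected) (hH' : ¬ H.IsBipartite)
    (hT : ∀ x h, TrivialAt φ x h) : ∃ δ : G →g K, CanRecolor φ (δ.comp (tensorFst G H)) := by
  obtain ⟨n, s, hn, hs⟩ := exists_cyclic_sequence hH'
  obtain ⟨w, m, hw⟩ := exists_isTransport hK hG (exists_adj_of_not_isBipartite hH hH')
    (nonempty_twoWalk hH hH') hT (s 0)
  choose b M hM hmaj using fun x => exists_majority (K := K) (ι := Fin (n + 1))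
    (by simpa using hn) (φ (x, s 0)) (fun i => (w x (s i))⁻¹)
  -- A homotopy needs even walks, so a median at odd distance is moved to any neighbour. By
  -- `majority_step` the medians over all adjacent vertices then sit at the old position, so
  -- adjacency results.
  have hcorr : ∀ x, ∃ d D, K.IsWalkElt (φ (x, s 0)) d D ∧
      ((Even (norm (M x)) ∧ d = b x ∧ D = M x) ∨
        (¬ Even (norm (M x)) ∧ K.Adj (b x) d ∧ D = M x * arc (b x) d)) := by
    intro x
    by_cases hx : Even (norm (M x))
    · exact ⟨b x, M x, hM x, Or.inl ⟨hx, rfl, rfl⟩⟩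
    · have h1 : (M x)⁻¹ ≠ 1 := fun h => hx (by rw [inv_eq_one.1 h]; simp)
      obtain ⟨c, hc, -⟩ := (hM x).inv.exists_hd h1
      exact ⟨c, M x * arc (b x) c, (hM x).mul (.of_adj hc), Or.inr ⟨hx, hc, rfl⟩⟩
  choose d D hD hdD using hcorr
  have hDe : ∀ x, Even (norm (D x)) := by
    intro x
    rcases hdD x with ⟨h, -, e⟩ | ⟨h, -, e⟩
    · rwa [e]
    · rwa [e, even_norm_mul_arc]
  have hstep : ∀ x x', G.Adj x x' →
      K.Adj (d x) (d x') ∧ (D x)⁻¹ * m x x' * D x' = arc (d x) (d x') := by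
    intro x x' hx
    rcases hw.majority_step hs hx (hM x) (hM x') (hmaj x) (hmaj x') with
      ⟨e, ha, h1, h2⟩ | ⟨e, hb, h1⟩
    · rcases hdD x with ⟨-, ed, eD⟩ | ⟨h, -⟩
      · rcases hdD x' with ⟨-, ed', eD'⟩ | ⟨h, -⟩
        · rw [ed, eD, ed', eD']
          exact ⟨ha, e⟩
        · exact absurd h2 h
      · exact absurd h1 h
    · rcases hdD x with ⟨h, ed, eD⟩ | ⟨h, ha, eD⟩ <;>
      rcases hdD x' with ⟨h', ed', eD'⟩ | ⟨h', ha', eD'⟩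
      · tauto
      · rw [eD, eD', ed, ← mul_assoc, e, one_mul, hb]
        exact ⟨ha', rfl⟩
      · rw [eD, eD', ed', mul_inv_rev, mul_assoc, mul_assoc, ← mul_assoc (M x)⁻¹, e, mul_one,
          arc_inv ha.ne, ← hb]
        exact ⟨ha.symm, rfl⟩
      · tauto
  let δ : G →g K := ⟨d, fun {x x'} hx => (hstep x x' hx).1⟩
  refine ⟨δ, IsHomotopy.canRecolor (R := fun v => w v.1 v.2 * D v.1) ⟨?_, ?_, ?_⟩ ?_⟩
  · exact fun v => (hw.isWalkElt _ _).mul (hD _)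
  · intro v
    rw [FreeGroup.even_norm_mul]
    exact iff_of_true (hw.even _ _) (hDe _)
  · rintro ⟨x, h⟩ ⟨x', h'⟩ ⟨hx, hh⟩
    change _ = _ * arc (d x) (d x')
    rw [← (hstep x x' hx).2, ← mul_assoc, hw.comm hx hh]
    group
  · intro t N ht
    have hw1 := hw.eq_one_of_tight hH hH' ht
    -- All lifts over this vertex are the base point, and a median elsewhere would see all of them
    -- in one direction.
    have hM1 : M (t 0).1 = 1 := by
      by_contra h1
      obtain ⟨c, hc, hdc⟩ := (hM (t 0).1).inv.exists_hd (inv_ne_one.2 h1)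
      have := hmaj _ c hc
      simp only [hw1, inv_one, mul_one, hdc, Finset.filter_true, Finset.card_univ] at this
      omega
    rcases hdD (t 0).1 with ⟨-, -, e⟩ | ⟨h, -⟩
    · change w _ _ * D _ = 1
      rw [e, hM1, hw1, mul_one]
    · rw [hM1] at h
      simp at h

end Projection

/-! ### The axis of a closed walk -/

section Axis

variable {W : Type*} [LinearOrder W] {K : SimpleGraph W}

/-- Every closed walk is conjugate to a cyclically reduced one. -/
lemma IsWalkElt.exists_conj {a : W} {c : FreeGroup (W × W)} (hc : K.IsWalkElt a a c)
    (h1 : c ≠ 1) : ∃ k t, K.IsWalkElt a k t ∧ hd (t⁻¹ * c * t) ≠ hd (t⁻¹ * c * t)⁻¹ := by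
  let S := {q : W × FreeGroup (W × W) // K.IsWalkElt a q.1 q.2}
  have : Nonempty S := ⟨⟨(a, 1), .one a⟩⟩
  let cost : S → ℕ := fun q => norm (q.1.2⁻¹ * c * q.1.2)
  obtain ⟨⟨⟨k, t⟩, ht⟩, hmin⟩ : ∃ q, ∀ q', cost q ≤ cost q' :=
    ⟨Function.argmin cost, fun q' => Function.argmin_le cost q'⟩
  refine ⟨k, t, ht, fun heq => ?_⟩
  have hd1 : t⁻¹ * c * t ≠ 1 := by
    intro h
    apply h1
    have : c = t * (t⁻¹ * c * t) * t⁻¹ := by group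
    rw [this, h]
    group
  have hdW : K.IsWalkElt k k (t⁻¹ * c * t) := (ht.inv.mul hc).mul ht
  obtain ⟨k₁, hk₁, hhd⟩ := hdW.exists_hd hd1
  -- If `d` starts and ends on the same edge, in opposite directions, conjugating by that arc
  -- shortens it by two, against minimality.
  have h2 := hmin ⟨(k₁, t * arc k k₁), ht.mul (.of_adj hk₁)⟩
  simp only [cost] at h2
  rw [show (t * arc k k₁)⁻¹ * c * (t * arc k k₁) = (arc k k₁)⁻¹ * (t⁻¹ * c * t) * arc k k₁ by
    group, arc_inv hk₁.ne] at h2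
  set d := t⁻¹ * c * t with hd_def
  have n1 := norm_arc_mul_of_eq hk₁.ne.symm hhd
  set y := arc k₁ k * d with hy
  have hdy : d = arc k k₁ * y := by rw [hy, ← mul_assoc, arc_mul_arc hk₁.ne, one_mul]
  by_cases hy1 : y = 1
  · rw [hy1, mul_one] at hdy
    rw [hdy, arc_inv hk₁.ne, hd_arc, hd_arc, Option.some.injEq, arcLetter_inj] at heq
    exact hk₁.ne heq.1
  · have hyi : hd (y⁻¹) = some (arcLetter k k₁) := by
      have hne : hd (y⁻¹)⁻¹ ≠ hd (arc k₁ k) := by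
        intro h
        rw [inv_inv, hd_arc] at h
        have := norm_arc_mul_of_eq hk₁.ne h
        rw [← hdy] at this
        omega
      have := FreeGroup.hd_mul_of_hd (inv_ne_one.2 hy1) hne
      rw [← this, ← arc_inv hk₁.ne, ← mul_inv_rev, ← hdy, ← heq, hhd]
    have n2 := norm_arc_mul_of_eq hk₁.ne.symm hyi
    rw [FreeGroup.norm_inv_eq, ← FreeGroup.norm_inv_eq (x := arc k₁ k * y⁻¹), mul_inv_rev, inv_inv,
      arc_inv hk₁.ne.symm] at n2
    omega

lemma walkElt_eq_seqElt {a b : W} (p : K.Walk a b) :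
    walkElt p = seqElt p.getVert 0 p.length := by
  induction p with
  | nil => rfl
  | cons h p ih =>
    rw [walkElt, Walk.length_cons, add_comm, seqElt_add, seqElt_one, ih]
    congr 1
    · simp
    · exact seqElt_congr fun k _ => by simp [add_comm]

/-- A cyclically reduced closed walk, repeated periodically. -/
lemma exists_axis {k : W} {c : FreeGroup (W × W)} (hc : K.IsWalkElt k k c) (h1 : c ≠ 1)
    (hcyc : hd c ≠ hd c⁻¹) : ∃ s : ℕ → W, s 0 = k ∧ seqElt s 0 (norm c) = c ∧
      (∀ i, s (i + norm c) = s i) ∧ (∀ i, K.Adj (s i) (s (i + 1))) ∧ ∀ i, s i ≠ s (i + 2) := by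
  obtain ⟨p, hp, hl⟩ := hc.exists_walk
  set n := norm c with hn
  have hn0 : 0 < n := Nat.pos_of_ne_zero fun h => h1 (FreeGroup.norm_eq_zero.1 h)
  let s : ℕ → W := fun i => p.getVert (i % n)
  have hs : ∀ i ≤ n, s i = p.getVert i := by
    intro i hi
    rcases hi.lt_or_eq with h | rfl
    · simp only [s, Nat.mod_eq_of_lt h]
    · simp only [s, Nat.mod_self, Walk.getVert_zero]
      rw [← hl, Walk.getVert_length]
  have hper : ∀ i, s (i + n) = s i := fun i => by simp [s]
  have hmod : ∀ i, s i = s (i % n) := fun i => by simp [s]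
  have hmod' : ∀ i j, s (i + j) = s (i % n + j) := fun i j => by simp [s]
  have hadj : ∀ i, K.Adj (s i) (s (i + 1)) := by
    intro i
    have hi := Nat.mod_lt i hn0
    rw [hmod i, hmod' i 1, hs _ hi.le, hs _ hi]
    exact p.adj_getVert_succ (by omega)
  have hsc : seqElt s 0 n = c := by
    rw [← hp, walkElt_eq_seqElt, hl]
    exact seqElt_congr fun j hj => by simpa using hs j hj
  refine ⟨s, by simp [s], hsc, hper, hadj, fun i heq => ?_⟩
  rw [hmod i, hmod' i 2] at heq
  have hi := Nat.mod_lt i hn0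
  set i₀ := i % n
  -- A backtrack may straddle the end of a period, so two periods are considered. Deleting it would
  -- write the reduced product `c * c` with only `2 * n - 2` arcs.
  have e1 : seqElt s 0 (n + n) = c * c := by
    rw [seqElt_add, hsc, zero_add]
    congr 1
    rw [← hsc]
    exact seqElt_congr fun j _ => by rw [zero_add, add_comm, hper]
  have e2 : norm (c * c) = n + n := FreeGroup.norm_mul_of_hd (Or.inr hcyc.symm)
  have e3 : seqElt s 0 (n + n) = seqElt s 0 i₀ * seqElt s (i₀ + 2) (n + n - (i₀ + 2)) := by
    have : n + n = i₀ + (2 + (n + n - (i₀ + 2))) := by omega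
    conv_lhs => rw [this, seqElt_add, seqElt_add, zero_add]
    have e4 : seqElt s i₀ 2 = 1 := by
      simp only [seqElt, add_zero, one_mul]
      rw [← heq, arc_mul_arc (hadj i₀).ne]
    rw [e4, one_mul]
  have n1 := norm_seqElt_le s 0 i₀
  have n2 := norm_seqElt_le s (i₀ + 2) (n + n - (i₀ + 2))
  have n3 := FreeGroup.norm_mul_le (seqElt s 0 i₀) (seqElt s (i₀ + 2) (n + n - (i₀ + 2)))
  rw [← e3, e1, e2] at n3
  omega

/-- An infinite non-backtracking sequence with period `n`, whose period has the element `c`. -/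
structure IsAxis (K : SimpleGraph W) (s : ℕ → W) (n : ℕ) (c : FreeGroup (W × W)) : Prop where
  elt : seqElt s 0 n = c
  periodic : ∀ i, s (i + n) = s i
  adj : ∀ i, K.Adj (s i) (s (i + 1))
  ne : ∀ i, s i ≠ s (i + 2)
  pos : 0 < n

namespace IsAxis

variable {s : ℕ → W} {n : ℕ} {c : FreeGroup (W × W)}

lemma three_le (hs : IsAxis K s n c) : 3 ≤ n := by
  have h0 := hs.pos
  by_contra h
  have h1 := hs.adj 0
  have h2 := hs.ne 0
  have h3 := hs.periodic 0
  obtain rfl | rfl : n = 1 ∨ n = 2 := by omega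
  · exact h1.ne h3.symm
  · exact h2 h3.symm

lemma apply_mod (hs : IsAxis K s n c) (i : ℕ) : s (i % n) = s i := by
  have := apply_add_mul_of_periodic hs.periodic (i % n) (i / n)
  rw [← this, mul_comm, Nat.mod_add_div]

lemma congr (hs : IsAxis K s n c) {i j : ℕ} (h : i ≡ j [MOD n]) : s i = s j := by
  rw [← hs.apply_mod i, ← hs.apply_mod j, h]

lemma elt_add_mul (hs : IsAxis K s n c) (i k : ℕ) :
    seqElt s 0 (i + k * n) = c ^ k * seqElt s 0 i := by
  induction k with
  | zero => simp
  | succ k ih =>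
    rw [show i + (k + 1) * n = n + (i + k * n) by ring, seqElt_add, hs.elt, pow_succ', mul_assoc,
      ← ih]
    congr 1
    exact seqElt_congr fun j _ => by rw [zero_add, zero_add, add_comm, hs.periodic]

/-- The walk along the axis between two of its points. -/
lemma segment (hs : IsAxis K s n c) (i j : ℕ) (t : ℤ) :
    ∃ i' j', i' ≡ i [MOD n] ∧ j' ≡ j [MOD n] ∧ 0 < i' ∧ 0 < j' ∧
      (seqElt s 0 i)⁻¹ * c ^ t * seqElt s 0 j = (seqElt s 0 i')⁻¹ * seqElt s 0 j' := by
  have hn := hs.pos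
  have hm : ∀ i k, i + k * n ≡ i [MOD n] := fun i k => by simp [Nat.ModEq]
  obtain ⟨m, rfl | rfl⟩ := Int.eq_nat_or_neg t
  · refine ⟨i + 1 * n, j + (m + 1) * n, hm _ _, hm _ _, by omega, by positivity, ?_⟩
    rw [hs.elt_add_mul, hs.elt_add_mul, zpow_natCast]
    group
  · refine ⟨i + (m + 1) * n, j + 1 * n, hm _ _, hm _ _, by positivity, by omega, ?_⟩
    rw [hs.elt_add_mul, hs.elt_add_mul, zpow_neg, zpow_natCast]
    group

/-- Writing the predecessor as `i + n - 1` avoids truncated subtraction at `0`. -/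
lemma apply_pred (hs : IsAxis K s n c) {i i' : ℕ} (h : i' + 1 ≡ i [MOD n]) :
    s i' = s (i + n - 1) := by
  apply hs.congr
  have hn := hs.pos
  apply Nat.ModEq.add_right_cancel' 1
  rw [show i + n - 1 + 1 = i + n by omega]
  exact h.trans (by simp [Nat.ModEq])

/-- `σ` runs along the axis and is reduced: it stands still, goes forward or goes backward. -/
lemma segment_cases (hs : IsAxis K s n c) (i j : ℕ) (t : ℤ) {σ : FreeGroup (W × W)}
    (hσ : σ = (seqElt s 0 i)⁻¹ * c ^ t * seqElt s 0 j) :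
    (σ = 1 ∧ i ≡ j [MOD n]) ∨
      (σ ≠ 1 ∧ (hd σ = some (arcLetter (s i) (s (i + 1))) ∨
          hd σ = some (arcLetter (s i) (s (i + n - 1)))) ∧
        (norm σ = 1 → σ = arc (s i) (s j) ∧ (j ≡ i + 1 [MOD n] ∨ i ≡ j + 1 [MOD n]))) := by
  obtain ⟨i', j', hi, hj, hi0, hj0, e⟩ := hs.segment i j t
  rw [e] at hσ
  rcases lt_trichotomy i' j' with h | rfl | h
  · right
    obtain ⟨d, rfl⟩ := Nat.exists_eq_add_of_lt h
    rw [add_assoc, seqElt_add, inv_mul_cancel_left, zero_add] at hσ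
    have h1 := hd_seqElt hs.adj hs.ne i' d
    have h2 := norm_seqElt hs.adj hs.ne i' (d + 1)
    rw [← hσ] at h1 h2
    rw [hs.congr hi, hs.congr (hi.add_right 1)] at h1
    refine ⟨FreeGroup.ne_one_of_hd h1, Or.inl h1, fun hn => ?_⟩
    obtain rfl : d = 0 := by omega
    rw [seqElt_one, hs.congr hi, hs.congr (show i' + 1 ≡ j [MOD n] from hj)] at hσ
    exact ⟨hσ, Or.inl (hj.symm.trans (hi.add_right 1))⟩
  · left
    rw [inv_mul_cancel] at hσ
    exact ⟨hσ, hi.symm.trans hj⟩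
  · right
    obtain ⟨d, rfl⟩ := Nat.exists_eq_add_of_lt h
    rw [add_assoc, seqElt_add, mul_inv_rev, mul_assoc, inv_mul_cancel, mul_one, zero_add] at hσ
    have h1 := hd_inv_seqElt hs.adj hs.ne j' d
    have h2 := norm_seqElt hs.adj hs.ne j' (d + 1)
    rw [← hσ] at h1
    rw [← FreeGroup.norm_inv_eq, ← hσ] at h2
    rw [hs.congr hi, hs.apply_pred hi] at h1
    refine ⟨FreeGroup.ne_one_of_hd h1, Or.inr h1, fun hn => ?_⟩
    obtain rfl : d = 0 := by omega
    rw [seqElt_one, arc_inv (hs.adj _).ne, hs.congr hj,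
      hs.congr (show j' + 1 ≡ i [MOD n] from hi)] at hσ
    exact ⟨hσ, Or.inr (hi.symm.trans (hj.add_right 1))⟩

/-- The shortest walk to the axis. -/
lemma exists_nearest (hs : IsAxis K s n c) (w : FreeGroup (W × W)) :
    ∃ (t : ℤ) (i : ℕ), hd (w * c ^ t * seqElt s 0 i)⁻¹ ≠ some (arcLetter (s i) (s (i + 1))) ∧
      hd (w * c ^ t * seqElt s 0 i)⁻¹ ≠ some (arcLetter (s i) (s (i + n - 1))) := by
  let cost : ℤ × ℕ → ℕ := fun q => norm (w * c ^ q.1 * seqElt s 0 q.2)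
  obtain ⟨⟨t, i⟩, hmin⟩ : ∃ q, ∀ q', cost q ≤ cost q' :=
    ⟨Function.argmin cost, fun q' => Function.argmin_le cost q'⟩
  have hn := hs.pos
  -- If the shortest walk arrived along the axis from `s i'`, stopping there would be shorter.
  have key : ∀ (t' : ℤ) (i' : ℕ), K.Adj (s i) (s i') →
      seqElt s 0 i * arc (s i) (s i') = c ^ t' * seqElt s 0 i' →
      hd (w * c ^ t * seqElt s 0 i)⁻¹ ≠ some (arcLetter (s i) (s i')) := by
    intro t' i' ha he hh
    have h1 := norm_arc_mul_of_eq ha.ne.symm hh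
    have h2 := hmin (t + t', i')
    simp only [cost] at h2
    have e : (arc (s i') (s i) * (w * c ^ t * seqElt s 0 i)⁻¹)⁻¹ =
        w * c ^ (t + t') * seqElt s 0 i' := by
      rw [mul_inv_rev, inv_inv, arc_inv ha.ne.symm, mul_assoc _ (seqElt s 0 i), he, zpow_add]
      group
    rw [← FreeGroup.norm_inv_eq (x := arc (s i') (s i) * _), e, FreeGroup.norm_inv_eq] at h1
    omega
  have hp : s (i + n - 1 + 1) = s i := by rw [show i + n - 1 + 1 = i + n by omega, hs.periodic]
  -- The exponent `-1` compensates for the extra period in the index `i + n - 1`.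
  refine ⟨t, i, key 0 (i + 1) (hs.adj i) (by simp [seqElt]), key (-1) (i + n - 1) ?_ ?_⟩
  · have := hs.adj (i + n - 1)
    rw [hp] at this
    exact this.symm
  · have ha := hs.adj (i + n - 1)
    have e1 : seqElt s 0 (i + n) =
        seqElt s 0 (i + n - 1) * arc (s (i + n - 1)) (s i) := by
      conv_lhs => rw [show i + n = i + n - 1 + 1 by omega, seqElt, zero_add, hp]
    rw [hp] at ha
    have e2 := hs.elt_add_mul i 1
    rw [one_mul, pow_one, e1, ← eq_mul_inv_iff_mul_eq, arc_inv ha.ne] at e2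
    rw [e2]
    group

end IsAxis

end Axis

/-! ### Recoloring to a cycle -/

section Cycle

variable {X W : Type*} [LinearOrder W] {F : SimpleGraph X} {K : SimpleGraph W} {f : F →g K}

/-- A choice, for every vertex, of a shortest walk `r v` from `f v` to the point `s (i v)` of an
axis; the choices are compatible with the edges up to translations of the axis. -/
structure IsRetraction (f : F →g K) (s : ℕ → W) (n : ℕ) (c : FreeGroup (W × W)) (i : X → ℕ)
    (r : X → FreeGroup (W × W)) : Prop where
  isWalkElt : ∀ v, K.IsWalkElt (f v) (s (i v)) (r v)
  hd_succ : ∀ v, hd (r v)⁻¹ ≠ some (arcLetter (s (i v)) (s (i v + 1)))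
  hd_pred : ∀ v, hd (r v)⁻¹ ≠ some (arcLetter (s (i v)) (s (i v + n - 1)))
  comm : ∀ {u v}, F.Adj u v → ∃ t : ℤ,
    arc (f u) (f v) * r v = r u * ((seqElt s 0 (i u))⁻¹ * c ^ t * seqElt s 0 (i v))

namespace IsRetraction

variable {s : ℕ → W} {n : ℕ} {c : FreeGroup (W × W)} {i : X → ℕ} {r : X → FreeGroup (W × W)}

/-- Shortest walks to the axis do not arrive along it, so they cannot cancel against a nontrivial
segment `σ` of it. -/
lemma norm_conj (hs : IsAxis K s n c) (hr : IsRetraction f s n c i r) {u v : X} {t : ℤ}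
    {σ : FreeGroup (W × W)}
    (hσ : σ = (seqElt s 0 (i u))⁻¹ * c ^ t * seqElt s 0 (i v)) (h1 : σ ≠ 1) :
    norm (r u * σ * (r v)⁻¹) = norm (r u) + norm σ + norm (r v) := by
  have hσ' : σ⁻¹ = (seqElt s 0 (i v))⁻¹ * c ^ (-t) * seqElt s 0 (i u) := by
    rw [hσ]
    group
  have := FreeGroup.norm_triple (u := (r u)⁻¹) (v := (r v)⁻¹) h1 ?_ ?_
  · simpa only [inv_inv, FreeGroup.norm_inv_eq] using this
  · rcases hs.segment_cases _ _ _ hσ with ⟨h, -⟩ | ⟨-, h | h, -⟩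
    · exact absurd h h1
    · rw [h]
      exact hr.hd_succ u
    · rw [h]
      exact hr.hd_pred u
  · rcases hs.segment_cases _ _ _ hσ' with ⟨h, -⟩ | ⟨-, h | h, -⟩
    · exact absurd (inv_eq_one.1 h) h1
    · rw [h]
      exact (hr.hd_succ v).symm
    · rw [h]
      exact (hr.hd_pred v).symm

/-- An arc has norm one: if the nearest points differ, their segment uses up the whole arc, which
therefore lies on the axis. -/
lemma edge_cases (hs : IsAxis K s n c) (hr : IsRetraction f s n c i r) {u v : X}
    (huv : F.Adj u v) :
    (r u = 1 ∧ r v = 1 ∧ arc (f u) (f v) = arc (s (i u)) (s (i v)) ∧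
        (i v ≡ i u + 1 [MOD n] ∨ i u ≡ i v + 1 [MOD n])) ∨
      (i u ≡ i v [MOD n] ∧ arc (f u) (f v) * r v = r u) := by
  obtain ⟨t, ht⟩ := hr.comm huv
  obtain ⟨σ, hσ⟩ : ∃ σ, σ = (seqElt s 0 (i u))⁻¹ * c ^ t * seqElt s 0 (i v) := ⟨_, rfl⟩
  rw [← hσ] at ht
  rcases hs.segment_cases _ _ _ hσ with ⟨h, hm⟩ | ⟨h1, -, h2⟩
  · right
    rw [h, mul_one] at ht
    exact ⟨hm, ht⟩
  · left
    have hn := hr.norm_conj hs hσ h1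
    rw [← ht, mul_inv_cancel_right, norm_arc] at hn
    have hpos : norm σ ≠ 0 := fun h => h1 (FreeGroup.norm_eq_zero.1 h)
    have hu : r u = 1 := FreeGroup.norm_eq_zero.1 (by omega)
    have hv : r v = 1 := FreeGroup.norm_eq_zero.1 (by omega)
    obtain ⟨h3, h4⟩ := h2 (by omega)
    refine ⟨hu, hv, ?_, h4⟩
    rw [hu, hv, mul_one, one_mul] at ht
    rw [ht, h3]

/-- Tight closed walks lie on the axis. -/
lemma eq_one_of_tight (hs : IsAxis K s n c) (hr : IsRetraction f s n c i r) {q : ℕ → X} {N : ℕ}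
    (hq : IsTight f q N) : r (q 0) = 1 := by
  have key : ∀ m, ∃ t : ℤ, seqElt (fun j => f (q j)) 0 m * r (q m) =
      r (q 0) * ((seqElt s 0 (i (q 0)))⁻¹ * c ^ t * seqElt s 0 (i (q m))) := by
    intro m
    induction m with
    | zero => exact ⟨0, by simp [seqElt]⟩
    | succ m ih =>
      obtain ⟨t, ht⟩ := ih
      obtain ⟨t', ht'⟩ := hr.comm (hq.adj m)
      refine ⟨t + t', ?_⟩
      rw [seqElt, zero_add, mul_assoc, ht', ← mul_assoc, ht, zpow_add]
      group
  obtain ⟨t, ht⟩ := key N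
  have hqN : q N = q 0 := by
    have := hq.periodic 0
    rwa [zero_add] at this
  rw [hqN] at ht
  obtain ⟨σ, hσ⟩ : ∃ σ, σ = (seqElt s 0 (i (q 0)))⁻¹ * c ^ t * seqElt s 0 (i (q 0)) := ⟨_, rfl⟩
  rw [← hσ, ← eq_mul_inv_iff_mul_eq] at ht
  have hadj : ∀ j, K.Adj (f (q j)) (f (q (j + 1))) := fun j => f.map_adj (hq.adj j)
  have n1 := norm_seqElt hadj hq.ne 0 N
  have n2 := norm_seqElt hadj hq.ne 0 (N + N)
  have hpos := hq.pos
  have e : seqElt (fun j => f (q j)) (0 + N) N = seqElt (fun j => f (q j)) 0 N :=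
    seqElt_congr fun j _ => by rw [zero_add, zero_add, add_comm, hq.periodic]
  rw [seqElt_add, e, ht] at n2
  rw [ht] at n1
  have h1 : σ ≠ 1 := by
    intro h
    rw [h, mul_one, mul_inv_cancel, FreeGroup.norm_one] at n1
    omega
  -- The closed walk has norm `N = 2 * norm r + norm σ`, with `r = r (q 0)`. Its square is tight
  -- too, of norm `2 * N`, but is at most `2 * norm r + 2 * norm σ`; hence `r` is trivial.
  have n3 := hr.norm_conj hs hσ h1
  have n4 := FreeGroup.norm_mul_le (r (q 0) * σ * σ) (r (q 0))⁻¹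
  have n5 := FreeGroup.norm_mul_le (r (q 0) * σ) σ
  have n6 := FreeGroup.norm_mul_le (r (q 0)) σ
  rw [show r (q 0) * σ * (r (q 0))⁻¹ * (r (q 0) * σ * (r (q 0))⁻¹) =
    r (q 0) * σ * σ * (r (q 0))⁻¹ by group] at n2
  rw [FreeGroup.norm_inv_eq] at n4
  exact FreeGroup.norm_eq_zero.1 (by omega)

end IsRetraction

/-- The closed walk along an axis, as a homomorphism from a cycle. -/
lemma IsAxis.exists_hom {s : ℕ → W} {n : ℕ} {c : FreeGroup (W × W)} (hs : IsAxis K s n c) :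
    ∃ δ : cycleGraph n →g K, ∀ j : Fin n, δ j = s j := by
  obtain ⟨m, rfl⟩ := Nat.exists_eq_add_of_le' (show 2 ≤ n from (by have := hs.three_le; omega))
  have key : ∀ u v : Fin (m + 2), u - v = 1 → K.Adj (s u) (s v) := by
    intro u v h
    obtain rfl : u = v + 1 := by rw [← h]; abel
    rw [Fin.val_add, hs.apply_mod]
    simpa using (hs.adj v).symm
  refine ⟨⟨fun j => s j, fun {u v} h => ?_⟩, fun _ => rfl⟩
  rcases cycleGraph_adj.1 h with h | h
  · exact key u v h
  · exact (key v u h).symm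

lemma exists_hom_cycleGraph {n : ℕ} (hn : 2 ≤ n) (i : X → ℕ)
    (hi : ∀ u v, F.Adj u v → i v ≡ i u + 1 [MOD n] ∨ i u ≡ i v + 1 [MOD n]) :
    ∃ γ : F →g cycleGraph n, ∀ v, (γ v : ℕ) = i v % n := by
  obtain ⟨m, rfl⟩ := Nat.exists_eq_add_of_le' hn
  have key : ∀ a b : ℕ, a ≡ b + 1 [MOD m + 2] →
      Fin.ofNat (m + 2) a - Fin.ofNat (m + 2) b = 1 := by
    intro a b h
    rw [sub_eq_iff_eq_add]
    ext
    simp only [Fin.val_ofNat, Fin.val_add, Fin.val_one, Nat.add_mod_mod]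
    rw [add_comm 1 b]
    exact h
  refine ⟨⟨fun v => Fin.ofNat (m + 2) (i v), fun {u v} h => ?_⟩, fun v => rfl⟩
  rw [cycleGraph_adj]
  rcases hi u v h with h | h
  · exact Or.inr (key _ _ h)
  · exact Or.inl (key _ _ h)

lemma IsRetraction.exists_canRecolor [Finite X] {s : ℕ → W} {n : ℕ} {c : FreeGroup (W × W)}
    {i : X → ℕ} {r : X → FreeGroup (W × W)} (hs : IsAxis K s n c)
    (hr : IsRetraction f s n c i r) :
    ∃ (γ : F →g cycleGraph n) (δ : cycleGraph n →g K), CanRecolor f (δ.comp γ) := by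
  classical
  -- Odd walks are extended by one arc forward on the axis. Adjacent vertices with the same nearest
  -- point have walks of opposite parity, so exactly one is shifted and the images become adjacent.
  have hcorr : ∀ v, ∃ (j : ℕ) (R : FreeGroup (W × W)),
      (Even (norm (r v)) ∧ j = i v ∧ R = r v) ∨
        (¬ Even (norm (r v)) ∧ j = i v + 1 ∧ R = r v * arc (s (i v)) (s (i v + 1))) := by
    intro v
    by_cases h : Even (norm (r v))
    · exact ⟨_, _, Or.inl ⟨h, rfl, rfl⟩⟩
    · exact ⟨_, _, Or.inr ⟨h, rfl, rfl⟩⟩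
  choose j R hR using hcorr
  have hedge : ∀ u v, F.Adj u v → (j v ≡ j u + 1 [MOD n] ∨ j u ≡ j v + 1 [MOD n]) ∧
      arc (f u) (f v) * R v = R u * arc (s (j u)) (s (j v)) := by
    intro u v huv
    rcases hr.edge_cases hs huv with ⟨hu, hv, ha, hm⟩ | ⟨hm, ha⟩
    · rcases hR u with ⟨-, hju, hRu⟩ | ⟨h, -⟩
      · rcases hR v with ⟨-, hjv, hRv⟩ | ⟨h, -⟩
        · rw [hju, hjv, hRu, hRv, hu, hv, mul_one, one_mul]
          exact ⟨hm, ha⟩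
        · simp [hv] at h
      · simp [hu] at h
    · have hpar := even_norm_arc_mul (f u) (f v) (r v)
      rw [ha] at hpar
      have hsi := hs.congr hm
      have hsi' := hs.congr (hm.add_right 1)
      rcases hR u with ⟨h, hju, hRu⟩ | ⟨h, hju, hRu⟩ <;>
      rcases hR v with ⟨h', hjv, hRv⟩ | ⟨h', hjv, hRv⟩
      · tauto
      · rw [hju, hjv, hRu, hRv, hsi, ← mul_assoc, ha]
        exact ⟨Or.inl (hm.symm.add_right 1), rfl⟩
      · rw [hju, hjv, hRu, hRv, ha, hsi, hsi', mul_assoc, arc_mul_arc (hs.adj _).ne, mul_one]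
        exact ⟨Or.inr (hm.add_right 1), rfl⟩
      · tauto
  have hn := hs.three_le
  obtain ⟨γ, hγ⟩ := exists_hom_cycleGraph (by omega) j fun u v h => (hedge u v h).1
  obtain ⟨δ, hδ⟩ := hs.exists_hom
  have hg : ∀ v, (δ.comp γ) v = s (j v) := by
    intro v
    change δ (γ v) = _
    rw [hδ, hγ, hs.apply_mod]
  refine ⟨γ, δ, IsHomotopy.canRecolor (R := R) ⟨fun v => ?_, fun v => ?_, fun {u v} huv => ?_⟩
    fun q N hq => ?_⟩
  · rw [hg]
    rcases hR v with ⟨-, hj, hRv⟩ | ⟨-, hj, hRv⟩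
    · rw [hj, hRv]
      exact hr.isWalkElt v
    · rw [hj, hRv]
      exact (hr.isWalkElt v).mul (.of_adj (hs.adj _))
  · rcases hR v with ⟨h, -, hRv⟩ | ⟨h, -, hRv⟩
    · rwa [hRv]
    · rwa [hRv, even_norm_mul_arc]
  · rw [hg, hg]
    exact (hedge u v huv).2
  · have h1 := hr.eq_one_of_tight hs hq
    rcases hR (q 0) with ⟨-, -, hRv⟩ | ⟨h, -⟩
    · rw [hRv, h1]
    · simp [h1] at h

lemma isWalkElt_map {u v : X} (p : F.Walk u v) : K.IsWalkElt (f u) (f v) (walkElt (p.map f)) :=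
  ⟨p.map f, rfl⟩

/-- If the images of all closed walks are homotopic to powers of a single closed walk, the
coloring can be recolored to one that factors through a cycle. -/
theorem exists_canRecolor_cycleGraph [Finite X] (hF : F.Preconnected) (v₀ : X)
    {c : FreeGroup (W × W)} (hc : K.IsWalkElt (f v₀) (f v₀) c) (h1 : c ≠ 1)
    (hcyc : ∀ p : F.Walk v₀ v₀, walkElt (p.map f) ∈ Subgroup.zpowers c) :
    ∃ n, 3 ≤ n ∧ ∃ (γ : F →g cycleGraph n) (δ : cycleGraph n →g K),
      CanRecolor f (δ.comp γ) := by
  obtain ⟨k, t, ht, htc⟩ := hc.exists_conj h1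
  set d := t⁻¹ * c * t with hd_def
  have hd1 : d ≠ 1 := by
    intro h
    rw [h, inv_one] at htc
    exact htc rfl
  obtain ⟨s, hs0, hsd, hper, hadj, hne⟩ := exists_axis ((ht.inv.mul hc).mul ht) hd1 htc
  have hs : IsAxis K s (norm d) d := ⟨hsd, hper, hadj, hne,
    Nat.pos_of_ne_zero fun h => hd1 (FreeGroup.norm_eq_zero.1 h)⟩
  have p : ∀ v, F.Walk v v₀ := fun v => (hF v v₀).some
  let w : X → FreeGroup (W × W) := fun v => walkElt ((p v).map f) * t
  have hw : ∀ v, K.IsWalkElt (f v) (s 0) (w v) := fun v => by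
    rw [hs0]
    exact (isWalkElt_map (p v)).mul ht
  choose τ i hi1 hi2 using fun v => hs.exists_nearest (w v)
  have hpow : ∀ m : ℕ, K.IsWalkElt (s 0) (s 0) (d ^ m) := by
    intro m
    induction m with
    | zero => exact .one _
    | succ m ih =>
      rw [pow_succ]
      refine ih.mul ?_
      rw [hs0]
      exact (ht.inv.mul hc).mul ht
  have hzpow : ∀ m : ℤ, K.IsWalkElt (s 0) (s 0) (d ^ m) := by
    intro m
    obtain ⟨l, rfl | rfl⟩ := Int.eq_nat_or_neg m
    · rw [zpow_natCast]
      exact hpow l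
    · rw [zpow_neg, zpow_natCast]
      exact (hpow l).inv
  refine ⟨norm d, hs.three_le, IsRetraction.exists_canRecolor (i := i)
    (r := fun v => w v * d ^ τ v * seqElt s 0 (i v)) hs ⟨fun v => ?_, hi1, hi2, fun {u v} huv => ?_⟩⟩
  · have := isWalkElt_seqElt hadj 0 (i v)
    rw [zero_add] at this
    exact ((hw v).mul (hzpow _)).mul this
  · obtain ⟨m, hm⟩ := hcyc (((p u).reverse.append (.cons huv .nil)).append (p v))
    simp only [Walk.map_append, walkElt_append, Walk.map_cons, Walk.map_nil, walkElt, mul_one,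
      ← Walk.reverse_map, walkElt_reverse] at hm
    have hm' : arc (f u) (f v) * w v = w u * d ^ m := by
      have e : d ^ m = t⁻¹ * c ^ m * t := by
        have := conj_zpow (i := m) (a := t⁻¹) (b := c)
        rw [inv_inv] at this
        exact this
      rw [e, hm]
      simp only [w]
      group
    refine ⟨-τ u + m + τ v, ?_⟩
    rw [← mul_assoc, ← mul_assoc, hm', zpow_add, zpow_add]
    group

end Cycle

/-! ### The dichotomy from commuting closed walks -/

section Main

/-- The centralizer of `x` is cyclic, hence abelian. -/
lemma commute_of_commute {α : Type*} {x y z : FreeGroup α} (hx : x ≠ 1) (hy : Commute y x)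
    (hz : Commute z x) : Commute y z := by
  have := FreeGroup.isCyclic_centralizer hx
  obtain ⟨g, hg⟩ := this.exists_generator
  obtain ⟨m, hm⟩ := hg ⟨y, Subgroup.mem_centralizer_singleton_iff.2 hy⟩
  obtain ⟨n, hn⟩ := hg ⟨z, Subgroup.mem_centralizer_singleton_iff.2 hz⟩
  have hm' : (g : FreeGroup α) ^ m = y := congrArg Subtype.val hm
  have hn' : (g : FreeGroup α) ^ n = z := congrArg Subtype.val hn
  rw [← hm', ← hn']
  exact (Commute.refl _).zpow_zpow m n

lemma exists_zpowers_of_commute {α : Type*} {x : FreeGroup α} (hx : x ≠ 1)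
    (N : Subgroup (FreeGroup α)) (hN : ∀ y ∈ N, Commute y x) :
    ∃ c ∈ N, ∀ y ∈ N, y ∈ Subgroup.zpowers c := by
  have := FreeGroup.isCyclic_centralizer hx
  have hle : N ≤ Subgroup.centralizer {x} := fun y hy =>
    Subgroup.mem_centralizer_singleton_iff.2 (hN y hy)
  have hcyc : IsCyclic N := isCyclic_of_injective (Subgroup.inclusion hle)
    (Subgroup.inclusion_injective hle)
  obtain ⟨c, hc⟩ := hcyc.exists_generator
  refine ⟨c, c.2, fun y hy => ?_⟩
  obtain ⟨n, hn⟩ := hc ⟨y, hy⟩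
  exact ⟨n, congrArg Subtype.val hn⟩

variable {U V W : Type*}

lemma CanRecolor.swapHom {G : SimpleGraph U} {H : SimpleGraph V} {K : SimpleGraph W}
    {φ ψ : tensorProd G H →g K} (h : CanRecolor φ ψ) : CanRecolor (swapHom φ) (swapHom ψ) := by
  refine Relation.ReflTransGen.lift SimpleGraph.swapHom (fun f g hfg => ?_) _ _ h
  intro u v hu hv
  have := hfg (u.2, u.1) (v.2, v.1) hu hv
  ext
  · exact congrArg Prod.snd this
  · exact congrArg Prod.fst this

variable [LinearOrder W]

/-- The elements of the images of the closed walks based at a vertex. -/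
def closedWalkElts {X : Type*} {F : SimpleGraph X} {K : SimpleGraph W} (f : F →g K) (v : X) :
    Subgroup (FreeGroup (W × W)) where
  carrier := {x | ∃ p : F.Walk v v, walkElt (p.map f) = x}
  one_mem' := ⟨.nil, rfl⟩
  mul_mem' := by
    rintro _ _ ⟨p, rfl⟩ ⟨q, rfl⟩
    exact ⟨p.append q, by rw [Walk.map_append, walkElt_append]⟩
  inv_mem' := by
    rintro _ ⟨p, rfl⟩
    exact ⟨p.reverse, by rw [← Walk.reverse_map, walkElt_reverse]⟩

variable {G : SimpleGraph U} {H : SimpleGraph V} {K : SimpleGraph W} {φ : tensorProd G H →g K}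

lemma exists_walk_zigzag {x x' : U} (hx : G.Adj x x') {h k : V} (Q : TwoWalk H h k) :
    ∃ p : (tensorProd G H).Walk (x, h) (x, k), walkElt (p.map φ) = zigzag φ x x' Q := by
  induction Q with
  | nil => exact ⟨.nil, rfl⟩
  | cons a b Q ih =>
    obtain ⟨p, hp⟩ := ih
    refine ⟨.cons (tensor_adj hx a) (.cons (tensor_adj hx.symm b) p), ?_⟩
    simp [walkElt, zigzag, hp, mul_assoc]

/-- If neither factor is homotopically trivial, the images of all closed walks are powers of a
single one. -/
lemma exists_generator_closedWalkElts (hK : K.SquareFree) {x : U} {h : V}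
    (hG : ¬ TrivialAt (swapHom φ) h x) (hH : ¬ TrivialAt φ x h) :
    ∃ c ∈ closedWalkElts φ (x, h), c ≠ 1 ∧
      ∀ y ∈ closedWalkElts φ (x, h), y ∈ Subgroup.zpowers c := by
  simp only [TrivialAt, not_forall] at hG hH
  obtain ⟨h', hh, P, ha⟩ := hG
  obtain ⟨x', hx, Q, hb⟩ := hH
  have hcomm : ∀ (P : TwoWalk G x x) (Q : TwoWalk H h h),
      Commute (zigzag (swapHom φ) h h' P) (zigzag φ x x' Q) := fun P Q =>
    (zigzag_comm hK Q P hx hx hh hh).symm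
  obtain ⟨c, hc, hgen⟩ := exists_zpowers_of_commute ha (closedWalkElts φ (x, h)) (by
    rintro _ ⟨p, rfl⟩
    by_cases h1 : walkElt (p.map φ) = 1
    · rw [h1]
      exact Commute.one_left _
    -- `p` may be odd, so its square is decomposed. `Q'` commutes with `P` as walks in different
    -- factors do; `P'` does because both commute with the nontrivial `Q`.
    obtain ⟨P', Q', e⟩ := exists_zigzag_mul_zigzag (φ := φ) hK (p.append p) (by simp)
    have e := e hh hx
    rw [Walk.map_append, walkElt_append] at e
    have hP' := commute_of_commute hb (hcomm P' Q) (hcomm P Q)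
    have hsq : Commute (walkElt (p.map φ) ^ 2) (zigzag (swapHom φ) h h' P) := by
      rw [pow_two, e]
      exact hP'.mul_left (hcomm P Q').symm
    -- The square is nontrivial since free groups are torsion-free, and both elements commute with
    -- it.
    exact commute_of_commute (fun h2 => h1 ((pow_eq_one_iff_left two_ne_zero).1 h2))
      (Commute.self_pow _ 2) hsq.symm)
  refine ⟨c, hc, fun h1 => hb ?_, hgen⟩
  have hmem := hgen _ (exists_walk_zigzag (φ := φ) hx Q)
  rwa [h1, Subgroup.zpowers_one_eq_bot, Subgroup.mem_bot] at hmem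

end Main

end SimpleGraph
theorem mainTheorem2 {U V W : Type*} [Finite U] [Finite V] [Finite W]
    (G : SimpleGraph U) (H : SimpleGraph V) (K : SimpleGraph W)
    (hK : K.SquareFree)
    (hG : G.Connected) (hG' : ¬ G.IsBipartite)
    (hH : H.Connected) (hH' : ¬ H.IsBipartite)
    (μ : SimpleGraph.tensorProd G H →g K) :
    ∃ μ' : SimpleGraph.tensorProd G H →g K,
      SimpleGraph.CanRecolor μ μ' ∧
        ((∃ δ : G →g K, μ' = δ.comp (SimpleGraph.tensorFst G H)) ∨
         (∃ δ : H →g K, μ' = δ.comp (SimpleGraph.tensorSnd G H)) ∨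
         (∃ n : ℕ, 3 ≤ n ∧
            ∃ (γ : SimpleGraph.tensorProd G H →g SimpleGraph.cycleGraph n)
              (δ : SimpleGraph.cycleGraph n →g K), μ' = δ.comp γ)) := by
  -- An arbitrary order, used only to orient the edges so that opposite arcs are inverse letters.
  obtain ⟨_⟩ : Nonempty (LinearOrder W) := ⟨IsWellOrder.linearOrder WellOrderingRel⟩
  obtain ⟨x₀⟩ := hG.nonempty
  obtain ⟨h₀⟩ := hH.nonempty
  have hconn := SimpleGraph.tensorProd_preconnected hG hG' hH hH'
  have hconn' := SimpleGraph.tensorProd_preconnected hH hH' hG hG'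
  by_cases hT : SimpleGraph.TrivialAt μ x₀ h₀
  · obtain ⟨δ, hδ⟩ := SimpleGraph.exists_canRecolor_tensorFst hK
      (SimpleGraph.exists_adj_of_not_isBipartite hG hG') hH hH' fun x h =>
        SimpleGraph.TrivialAt.of_reachable (u := (x₀, h₀)) (v := (x, h)) hK hT (hconn _ _)
    exact ⟨_, hδ, Or.inl ⟨δ, rfl⟩⟩
  by_cases hT' : SimpleGraph.TrivialAt (SimpleGraph.swapHom μ) h₀ x₀
  · obtain ⟨δ, hδ⟩ := SimpleGraph.exists_canRecolor_tensorFst hK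
      (SimpleGraph.exists_adj_of_not_isBipartite hH hH') hG hG' fun h x =>
        SimpleGraph.TrivialAt.of_reachable (u := (h₀, x₀)) (v := (h, x)) hK hT' (hconn' _ _)
    exact ⟨_, hδ.swapHom, Or.inr (Or.inl ⟨δ, rfl⟩)⟩
  · obtain ⟨c, ⟨p, hp⟩, hc1, hgen⟩ := SimpleGraph.exists_generator_closedWalkElts hK hT' hT
    obtain ⟨n, hn, γ, δ, hγδ⟩ := SimpleGraph.exists_canRecolor_cycleGraph hconn (x₀, h₀)
      ⟨p.map μ, hp⟩ hc1 fun q => hgen _ ⟨q, rfl⟩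
    exact ⟨_, hγδ, Or.inr (Or.inr ⟨n, hn, γ, δ, rfl⟩)⟩
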